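/- **Setting.** A $*$-incps (infinitesimal noncommutative $*$-probability space) is a triple $(\mathcal A,\varphi,\varphi')$ where $\mathcal A$ is a unital $*$-algebra over $\mathbb C$ and $\varphi,\varphi':\mathcal A\to\mathbb C$ are linear with $\varphi(1)=1$, $\varphi'(1)=0$, $\varphi(a^*a)\ge 0$ and $\varphi'(a^*)=\overline{\varphi'(a)}$ for all $a\in\mathcal A$. *Infinitesimal freeness.* Unital subalgebras $\mathcal A_1,\dots,\mathcal A_k$ of $\mathcal A$ are infinitesimally free if for all $n\ge1$, all $i_1,\dots,i_n$ with $i_1\ne i_2,\ i_2\neq i_3,\dots,\ i_{n-1}\ne i_n$, and all $a_m\in\mathcal A_{i_m}$ with $\varphi(a_1)=\dots=\varphi(a_n)=0$, one has $\varphi(a_1\cdots a_n)=0$ and $$\varphi'(a_1\cdots a_n)=\varphi(a_1a_n)\,\varphi(a_2a_{n-1})\cdots\varphi(a_{(n-1)/2}\,a_{(n+3)/2})\cdot\varphi'(a_{(n+1)/2})$$ if $n$ is odd and $i_m=i_{n+1-m}$ for all $m$, while $\varphi'(a_1\cdots a_n)=0$ otherwise. Subsets of $\mathcal A$ are infinitesimally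 free if the unital subalgebras they generate are, and elements are if the corresponding one-element subsets are. *Cumulants.* Let $NC(n)$ be the set of non-crossing partitions of $\{1,\dots,n\}$ ordered by reverse refinement, with maximal element $1_n$ and Möbius function $\text{Möb}$. For a linear functional $f$ on $\mathcal A$ and $V=\{v_1<\dots<v_m\}$ put $f_V(a_1,\dots,a_n)=f(a_{v_1}\cdots a_{v_m})$. For $n\ge1$ define (omitting the arguments $a_1,\dots,a_n$) $$\kappa_n=\sum_{\pi\in NC(n)}\text{Möb}(\pi,1_n)\prod_{V\in\pi}\varphi_V,\qquad \kappa_n'=\sum_{\pi\in NC(n)}\sum_{V\in\pi}\text{Möb}(\pi,1_n)\,\varphi'_V\prod_{W\in\pi,\,W\ne V}\varphi_W .$$ A selfadjoint $x\in\mathcal A$ is *standard infinitesimally semicircular* if $\kappa_n(x,\dots,x)=\kappa_n'(x,\dots,x)=0$ for all $n\ge3$, $\kappa_1(x)=0$ and $\kappa_2(x,x)=1$. For real $\lambda>0$, $\beta'$, $\gamma'$, a selfadjoint $y\in\mathcal A$ is *infinitesimally free Poisson* of parameter $\lambda$ and infinitesimal parameters $\beta',\gamma'$ if $\kappa_n(y,\dots,y)=\lambda$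 and $\kappa_n'(y,\dots,y)=\beta'+n\gamma'$ for all $n\ge1$. **Corollary 5.10.** Let $(\mathcal A,\varphi,\varphi')$ be a $*$-incps and let $x\in\mathcal A$ be standard infinitesimally semicircular. Let $e_1,\dots,e_k\in\mathcal A$ be projections ($e_i=e_i^*=e_i^2$) with $e_ie_j=0$ for $1\le i<j\le k$, such that $\{e_1,\dots,e_k\}$ is infinitesimally free from $\{x\}$. Then: 1. The elements $xe_1x,\dots,xe_kx$ are infinitesimally free in $(\mathcal A,\varphi,\varphi')$. 2. For every $1\le i\le k$, the numbers $\lambda_i=\varphi(e_i)$, $\beta_i'=\varphi'(e_i)$, $\gamma_i'=\varphi'(x^2)\,\varphi(e_i)$ are real, $xe_ix$ is selfadjoint, and $$\kappa_n(xe_ix,\dots,xe_ix)=\lambda_i,\qquad \kappa_n'(xe_ix,\dots,xe_ix)=\beta_i'+n\gamma_i'\qquad\text{for all } n\ge1 .$$ Thus, whenever $\varphi(e_i)\ne0$, the element $xe_ix$ is infinitesimally free Poisson of parameter $\lambda_i>0$ and infinitesimal parameters $\beta_i',\gamma_i'$. -/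

import Mathlib

namespace InfFree

/-! Non-crossing partitions of `Fin n`, ordered by reverse refinement. -/

/-- A partition is non-crossing if there are no `i < j < k < l` with `i, k` in one block and
`j, l` in another block. -/
def IsNonCrossing {n : ℕ} (π : Finpartition (Finset.univ : Finset (Fin n))) : Prop :=
  ∀ V ∈ π.parts, ∀ W ∈ π.parts, ∀ i j k l : Fin n, i < j → j < k → k < l →
    i ∈ V → k ∈ V → j ∈ W → l ∈ W → V = W

/-- `NC n`: the non-crossing partitions of `Fin n`. The order is the one inherited from
`Finpartition`: `π ≤ ρ` when every block of `π` is contained in a block of `ρ`. -/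
abbrev NC (n : ℕ) : Type :=
  {π : Finpartition (Finset.univ : Finset (Fin n)) // IsNonCrossing π}

theorem isNonCrossing_top (n : ℕ) :
    IsNonCrossing (⊤ : Finpartition (Finset.univ : Finset (Fin n))) := by
  intro V hV W hW i j k l _ _ _ _ _ _ _
  have h := Finpartition.parts_top_subset (Finset.univ : Finset (Fin n))
  rw [Finset.mem_singleton.mp (h hV), Finset.mem_singleton.mp (h hW)]

/-- The partition `1_n`, which for `n ≥ 1` has exactly one block. -/
noncomputable def NC.one (n : ℕ) : NC n := ⟨⊤, isNonCrossing_top n⟩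

noncomputable instance instFintypeNC (n : ℕ) : Fintype (NC n) := Fintype.ofFinite _

noncomputable instance instLocallyFiniteOrderNC (n : ℕ) : LocallyFiniteOrder (NC n) :=
  @Fintype.toLocallyFiniteOrder _ _ _ (Classical.decRel _) (Classical.decRel _)

/-- The value `Möb(π, 1_n)` of the Möbius function of the poset `NC n`. -/
noncomputable def moebOne {n : ℕ} (π : NC n) : ℂ :=
  IncidenceAlgebra.mu ℂ π (NC.one n)

section Cumulants

variable {A : Type*} [Ring A] [Algebra ℂ A]

/-- `f_{|V|}((a_1, …, a_n) | V) = f (a_{v_1} ⋯ a_{v_m})` for `V = {v_1 < ⋯ < v_m}`. -/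
noncomputable def blockMoment (f : A →ₗ[ℂ] ℂ) {n : ℕ} (a : Fin n → A) (V : Finset (Fin n)) : ℂ :=
  f (((V.sort (· ≤ ·)).map a).prod)

/-- The non-crossing cumulant `κ_n (a_1, …, a_n)` associated to `φ`. -/
noncomputable def cumulant (φ : A →ₗ[ℂ] ℂ) {n : ℕ} (a : Fin n → A) : ℂ :=
  ∑ π : NC n, moebOne π * ∏ V ∈ π.1.parts, blockMoment φ a V

/-- The infinitesimal non-crossing cumulant `κ_n' (a_1, …, a_n)` associated to `(φ, φ')`. -/
noncomputable def infCumulant (φ φ' : A →ₗ[ℂ] ℂ) {n : ℕ} (a : Fin n → A) : ℂ :=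
  ∑ π : NC n, ∑ V ∈ π.1.parts,
    moebOne π * blockMoment φ' a V * ∏ W ∈ π.1.parts.erase V, blockMoment φ a W

/-- Infinitesimal freeness of a family of unital subalgebras: if `a_1, …, a_n` (with `n ≥ 1`) are
centred elements of subalgebras whose consecutive indices are distinct, then `φ (a_1 ⋯ a_n) = 0`,
and `φ' (a_1 ⋯ a_n)` is `φ (a_1 a_n) φ (a_2 a_{n-1}) ⋯ φ' (a_{(n+1)/2})` if `n` is odd and the
word of indices is a palindrome, and is `0` otherwise. Positions are counted from `0`, and
`j.rev` is the position opposite to `j`. -/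
def InfinitesimallyFree (φ φ' : A →ₗ[ℂ] ℂ) {ι : Type*} (B : ι → Subalgebra ℂ A) : Prop :=
  ∀ (n : ℕ) (i : Fin n → ι) (a : Fin n → A), 0 < n →
    (∀ (j : ℕ) (h : j + 1 < n), i ⟨j, Nat.lt_of_succ_lt h⟩ ≠ i ⟨j + 1, h⟩) →
    (∀ j, a j ∈ B (i j)) → (∀ j, φ (a j) = 0) →
    φ (List.ofFn a).prod = 0 ∧
    (∀ (m : ℕ) (h : n = 2 * m + 1), (∀ j, i j = i j.rev) →
      φ' (List.ofFn a).prod =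
        (∏ j : Fin n with j.val < m, φ (a j * a j.rev)) * φ' (a ⟨m, by omega⟩)) ∧
    (¬ (Odd n ∧ ∀ j, i j = i j.rev) → φ' (List.ofFn a).prod = 0)

/-- Infinitesimal freeness of a family of subsets: that of the generated unital subalgebras. -/
def InfinitesimallyFreeSets (φ φ' : A →ₗ[ℂ] ℂ) {ι : Type*} (X : ι → Set A) : Prop :=
  InfinitesimallyFree φ φ' (fun i => Algebra.adjoin ℂ (X i))

end Cumulants

section Star

open scoped ComplexOrder

variable {A : Type*} [Ring A] [StarRing A] [Algebra ℂ A]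

/-- `(A, φ, φ')` is an infinitesimal noncommutative `*`-probability space. -/
structure IsStarIncps (φ φ' : A →ₗ[ℂ] ℂ) : Prop where
  map_one : φ 1 = 1
  map_one' : φ' 1 = 0
  nonneg : ∀ a, 0 ≤ φ (star a * a)
  selfAdjoint : ∀ a, φ' (star a) = star (φ' a)

/-- Infinitesimally semicircular elements. -/
structure IsInfSemicircular (φ φ' : A →ₗ[ℂ] ℂ) (x : A) : Prop where
  isSelfAdjoint : IsSelfAdjoint x
  cumulant_eq_zero : ∀ n, 3 ≤ n → cumulant φ (fun _ : Fin n => x) = 0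
  infCumulant_eq_zero : ∀ n, 3 ≤ n → infCumulant φ φ' (fun _ : Fin n => x) = 0

/-- Standard infinitesimally semicircular elements. -/
structure IsStandardInfSemicircular (φ φ' : A →ₗ[ℂ] ℂ) (x : A) : Prop
    extends IsInfSemicircular φ φ' x where
  cumulant_one : cumulant φ (fun _ : Fin 1 => x) = 0
  cumulant_two : cumulant φ (fun _ : Fin 2 => x) = 1

/-- `y` has the cumulants `κ_n (y, …, y) = l` and `κ_n' (y, …, y) = β + n γ`, for all `n ≥ 1`. -/
def HasInfFreePoissonCumulants (φ φ' : A →ₗ[ℂ] ℂ) (y : A) (l β γ : ℝ) : Prop :=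
  ∀ n, 1 ≤ n → cumulant φ (fun _ : Fin n => y) = (l : ℂ) ∧
    infCumulant φ φ' (fun _ : Fin n => y) = (β : ℂ) + (n : ℂ) * (γ : ℂ)

/-- `y` is infinitesimally free Poisson of parameter `l > 0` and infinitesimal parameters
`β`, `γ`. -/
structure IsInfFreePoisson (φ φ' : A →ₗ[ℂ] ℂ) (y : A) (l β γ : ℝ) : Prop where
  pos : 0 < l
  isSelfAdjoint : IsSelfAdjoint y
  cumulants : HasInfFreePoissonCumulants φ φ' y l β γ

end Star

end InfFree

/-! Over the dual numbers ℂ[ε] with ε² = 0, the pair (φ, φ') becomes one functional Φ = φ + εφ', and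
the infinitesimal notions become ordinary ones. Infinitesimal freeness of sets is freeness for Φ
(`infinitesimallyFreeSets_iff`), and κ_n + εκ_n' is the n-th free cumulant for Φ
(`cumulantSeq_dualFunctional`). What remains is free probability, done algebraically over a
commutative ring.

In that setting x = s + m, where m = εκ₁'(x) has square zero and s behaves as a centred semicircular
element of variance v = 1 + εφ'(x²). Wick products of s with elements free from s are combinations
of alternating centred words, so Φ kills them (`wick_mem_centredSpan`). Because the e_i are
orthogonal projections, the Wick products of s e_{i₁} 1 s e_{i₂} 1 ⋯ type obey a three-term
recursion in the elements s e_i s; they are therefore polynomials `poissonWord` in these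
(`poissonWord_eq_wick`). Replacing s by x adds only m times a combination of Wick products with an
odd number of letters s, which Φ also kills (`poissonWord_perturb`). So Φ vanishes on every nonempty
`poissonWord` in y_i = x e_i x (`map_poissonWord_compression`).

This vanishing gives both claims. Words factor where the index changes, and words in the single
index i span, together with 1, all polynomials in y_i; freeness follows
(`isFreeFamily_of_poissonWord`). The words in one index also determine the moments of y_i, which are
those of the free cumulants v^n Φ(e_i) (`map_pow_of_poissonWord`). Finally v^n Φ(e_i) = φ(e_i) +
ε(φ'(e_i) + nφ'(x²)φ(e_i)).

Moments and cumulants are matched by `stackMoment`, which counts non-crossing partitions while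
scanning points from left to right, followed by Möbius inversion (`cumulantSeq_stackMoment`). -/

namespace InfFree

/-! ### Counting non-crossing partitions by a stack recursion. -/

section Combinatorics

variable {α : Type*} [LinearOrder α] {R : Type*} [CommRing R]

/-- The set `P` of finsets is the set of blocks of a non-crossing partition of `S`. -/
structure IsNCPartition (S : Finset α) (P : Finset (Finset α)) : Prop where
  nonempty : ∀ V ∈ P, V.Nonempty
  subset : ∀ V ∈ P, V ⊆ S
  cover : ∀ a ∈ S, ∃ V ∈ P, a ∈ V
  eq_of_mem : ∀ V ∈ P, ∀ W ∈ P, ∀ a, a ∈ V → a ∈ W → V = W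
  noncrossing : ∀ V ∈ P, ∀ W ∈ P, ∀ i j k l, i < j → j < k → k < l →
    i ∈ V → k ∈ V → j ∈ W → l ∈ W → V = W

open Classical in
/-- The non-crossing partitions of `D ∪ T` all of whose blocks meet `T`. -/
noncomputable def ncPartitions (D T : Finset α) : Finset (Finset (Finset α)) :=
  (D ∪ T).powerset.powerset.filter
    (fun P => IsNCPartition (D ∪ T) P ∧ ∀ V ∈ P, ∃ t ∈ V, t ∈ T)

theorem mem_ncPartitions {D T : Finset α} {P : Finset (Finset α)} :
    P ∈ ncPartitions D T ↔ IsNCPartition (D ∪ T) P ∧ ∀ V ∈ P, ∃ t ∈ V, t ∈ T := by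
  classical
  simp only [ncPartitions, Finset.mem_filter, Finset.mem_powerset, and_iff_right_iff_imp]
  intro h V hV
  exact Finset.mem_powerset.2 (h.1.subset V hV)

theorem mem_ncPartitions_empty {T : Finset α} {P : Finset (Finset α)} :
    P ∈ ncPartitions ∅ T ↔ IsNCPartition T P := by
  rw [mem_ncPartitions, Finset.empty_union, and_iff_left_iff_imp]
  intro h V hV
  obtain ⟨t, ht⟩ := h.nonempty V hV
  exact ⟨t, ht, h.subset V hV ht⟩

/-- The moments `⟨X ^ a ξ_n, Ω⟩` of the operator `X = ℓ + ∑ c_{k+1} (ℓ*)^k` on the full Fock space over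
a line. -/
def stackMoment (c : ℕ → R) : ℕ → ℕ → R
  | 0, n => if n = 0 then 1 else 0
  | a + 1, n => stackMoment c a (n + 1) +
      ∑ k ∈ Finset.range (n + 1), c (k + 1) * stackMoment c a (n - k)

/-- The upper subsets of a finset. -/
def upperSubsets (D : Finset α) : Finset (Finset α) :=
  D.powerset.filter (fun U => ∀ u ∈ U, ∀ d ∈ D, u < d → d ∈ U)

theorem exists_upperSubset_card (D : Finset α) :
    ∀ k ≤ D.card, ∃ U ∈ upperSubsets D, U.card = k := by
  induction D using Finset.induction_on_min with
  | empty =>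
    intro k hk
    refine ⟨∅, by simp [upperSubsets], ?_⟩
    simpa [eq_comm] using hk
  | insert a s ha ih =>
    intro k hk
    have has : a ∉ s := fun h => lt_irrefl _ (ha a h)
    rw [Finset.card_insert_of_notMem has] at hk
    rcases Nat.lt_or_ge s.card k with h | h
    · refine ⟨insert a s, by simp +contextual [upperSubsets], ?_⟩
      rw [Finset.card_insert_of_notMem has]; omega
    · obtain ⟨U, hU, hc⟩ := ih k h
      refine ⟨U, ?_, hc⟩
      simp only [upperSubsets, Finset.mem_filter, Finset.mem_powerset] at hU ⊢
      refine ⟨hU.1.trans (Finset.subset_insert _ _), fun u hu d hd hud => ?_⟩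
      rcases Finset.mem_insert.1 hd with rfl | hd
      · exact absurd (ha u (hU.1 hu)) (not_lt.2 hud.le)
      · exact hU.2 u hu d hd hud

/-- Upper subsets of a finite chain are nested, so each is determined by its cardinality. They are
the possible sets of open points that a closing block can take from the top of the stack. -/
theorem sum_upperSubsets (D : Finset α) (f : ℕ → R) :
    ∑ U ∈ upperSubsets D, f U.card = ∑ k ∈ Finset.range (D.card + 1), f k := by
  refine Finset.sum_nbij Finset.card ?_ ?_ ?_ (fun _ _ => rfl)
  · intro U hU
    simp only [upperSubsets, Finset.mem_filter, Finset.mem_powerset] at hU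
    exact Finset.mem_range.2 (Nat.lt_succ_of_le (Finset.card_le_card hU.1))
  · intro U hU W hW h
    simp only [upperSubsets, Finset.coe_filter, Finset.mem_powerset, Set.mem_ofPred_eq] at hU hW
    by_cases hs : U ⊆ W
    · exact Finset.eq_of_subset_of_card_le hs h.ge
    · obtain ⟨u, hu, huW⟩ := Finset.not_subset.1 hs
      refine (Finset.eq_of_subset_of_card_le (fun w hw => ?_) h.le).symm
      rcases lt_trichotomy u w with h1 | h1 | h1
      · exact hU.2 u hu w (hW.1 hw) h1
      · exact h1 ▸ hu
      · exact absurd (hW.2 w hw u (hU.1 hu) h1) huW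
  · intro k hk
    obtain ⟨U, hU, hc⟩ := exists_upperSubset_card D k
      (Nat.le_of_lt_succ (Finset.mem_range.1 (by simpa using hk)))
    exact ⟨U, hU, hc⟩

/-- This is the case where the block of t continues into T: t joins the open points D, giving the
term `stackMoment c a (n + 1)`. -/
theorem ncPartitions_insert_of_isMin {D T : Finset α} {t : α} (P : Finset (Finset α)) :
    (P ∈ ncPartitions D (insert t T) ∧ ∀ V ∈ P, ∃ s ∈ V, s ∈ T) ↔
      P ∈ ncPartitions (insert t D) T := by
  have h : D ∪ insert t T = insert t D ∪ T := by
    rw [Finset.union_insert, Finset.insert_union]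
  rw [mem_ncPartitions, mem_ncPartitions, h]
  constructor
  · rintro ⟨⟨h1, -⟩, h2⟩
    exact ⟨h1, h2⟩
  · rintro ⟨h1, h2⟩
    refine ⟨⟨h1, fun V hV => ?_⟩, h2⟩
    obtain ⟨s, hs, hsT⟩ := h2 V hV
    exact ⟨s, hs, Finset.mem_insert_of_mem hsT⟩

/-- Nothing remaining lies between two points of the new block: U is upper in D, and T lies beyond
t. Hence closing this block creates no crossing. -/
theorem insert_mem_ncPartitions {D T : Finset α} {t : α} (hD : ∀ d ∈ D, d < t)
    (hT : ∀ s ∈ T, t < s) {U : Finset α} (hU : U ∈ upperSubsets D) {P : Finset (Finset α)}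
    (hP : P ∈ ncPartitions (D \ U) T) :
    insert (insert t U) P ∈ ncPartitions D (insert t T) := by
  simp only [upperSubsets, Finset.mem_filter, Finset.mem_powerset] at hU
  obtain ⟨hUD, hU⟩ := hU
  rw [mem_ncPartitions] at hP
  obtain ⟨hP, hPT⟩ := hP
  have key : ∀ W ∈ P, ∀ w ∈ W, w ∉ insert t U := by
    intro W hW w hw hwU
    have h1 := hP.subset W hW hw
    simp only [Finset.mem_union, Finset.mem_sdiff, Finset.mem_insert] at h1 hwU
    rcases h1 with h1 | h1
    · rcases hwU with rfl | hwU
      · exact lt_irrefl _ (hD _ h1.1)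
      · exact h1.2 hwU
    · rcases hwU with rfl | hwU
      · exact lt_irrefl _ (hT _ h1)
      · exact lt_asymm (hT _ h1) (hD _ (hUD hwU))
  have hle : ∀ w ∈ insert t U, w ≤ t := by
    intro w hw
    rcases Finset.mem_insert.1 hw with rfl | hw
    · exact le_rfl
    · exact (hD _ (hUD hw)).le
  have between : ∀ W ∈ P, ∀ i ∈ insert t U, ∀ j ∈ W, ∀ k ∈ insert t U, i < j → j < k → False := by
    intro W hW i hi j hj k hk hij hjk
    have hjt : j < t := hjk.trans_le (hle k hk)
    have h1 := hP.subset W hW hj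
    simp only [Finset.mem_union, Finset.mem_sdiff] at h1
    rcases h1 with h1 | h1
    · rcases Finset.mem_insert.1 hi with rfl | hi
      · exact lt_asymm hij hjt
      · exact h1.2 (hU i hi j h1.1 hij)
    · exact lt_asymm hjt (hT _ h1)
  rw [mem_ncPartitions]
  refine ⟨⟨?_, ?_, ?_, ?_, ?_⟩, ?_⟩
  · intro V hV
    rcases Finset.mem_insert.1 hV with rfl | hV
    · exact Finset.insert_nonempty _ _
    · exact hP.nonempty V hV
  · intro V hV
    rcases Finset.mem_insert.1 hV with rfl | hV
    · intro w hw
      rcases Finset.mem_insert.1 hw with rfl | hw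
      · simp
      · simp [hUD hw]
    · intro w hw
      have := hP.subset V hV hw
      simp only [Finset.mem_union, Finset.mem_sdiff] at this
      simp only [Finset.mem_union, Finset.mem_insert]
      tauto
  · intro a ha
    by_cases haU : a ∈ insert t U
    · exact ⟨_, Finset.mem_insert_self _ _, haU⟩
    · obtain ⟨V, hV, haV⟩ := hP.cover a (by
        simp only [Finset.mem_union, Finset.mem_sdiff, Finset.mem_insert] at ha haU ⊢
        tauto)
      exact ⟨V, Finset.mem_insert_of_mem hV, haV⟩
  · intro V hV W hW a haV haW
    rcases Finset.mem_insert.1 hV with rfl | hV <;> rcases Finset.mem_insert.1 hW with rfl | hW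
    · rfl
    · exact absurd haV (key W hW a haW)
    · exact absurd haW (key V hV a haV)
    · exact hP.eq_of_mem V hV W hW a haV haW
  · intro V hV W hW i j k l hij hjk hkl hi hk hj hl
    rcases Finset.mem_insert.1 hV with rfl | hV <;> rcases Finset.mem_insert.1 hW with rfl | hW
    · rfl
    · exact (between W hW i hi j hj k hk hij hjk).elim
    · exact (between V hV j hj k hk l hl hjk hkl).elim
    · exact hP.noncrossing V hV W hW i j k l hij hjk hkl hi hk hj hl
  · intro V hV
    rcases Finset.mem_insert.1 hV with rfl | hV
    · exact ⟨t, by simp, by simp⟩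
    · obtain ⟨s, hs, hsT⟩ := hPT V hV
      exact ⟨s, hs, Finset.mem_insert_of_mem hsT⟩

theorem erase_mem_ncPartitions {D T : Finset α} {t : α} (hD : ∀ d ∈ D, d < t)
    (hT : ∀ s ∈ T, t < s) {P : Finset (Finset α)} (hP : P ∈ ncPartitions D (insert t T))
    {V : Finset α} (hV : V ∈ P) (htV : t ∈ V) (hVT : ∀ s ∈ V, s ∉ T) :
    V.erase t ∈ upperSubsets D ∧ P.erase V ∈ ncPartitions (D \ V.erase t) T := by
  rw [mem_ncPartitions] at hP
  obtain ⟨hP, hPT⟩ := hP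
  have hmeet : ∀ W ∈ P, W ≠ V → ∃ s ∈ W, s ∈ T := by
    intro W hW hWV
    obtain ⟨s, hs, hsT⟩ := hPT W hW
    rcases Finset.mem_insert.1 hsT with rfl | hsT
    · exact absurd (hP.eq_of_mem W hW V hV _ hs htV) hWV
    · exact ⟨s, hs, hsT⟩
  have hsub : V.erase t ⊆ D := by
    intro w hw
    obtain ⟨hwt, hwV⟩ := Finset.mem_erase.1 hw
    have := hP.subset V hV hwV
    have := hVT w hwV
    simp only [Finset.mem_union, Finset.mem_insert] at *
    tauto
  constructor
  · simp only [upperSubsets, Finset.mem_filter, Finset.mem_powerset]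
    refine ⟨hsub, fun u hu d hd hud => ?_⟩
    obtain ⟨W, hW, hdW⟩ := hP.cover d (Finset.mem_union_left _ hd)
    by_cases hWV : W = V
    · subst hWV
      exact Finset.mem_erase.2 ⟨(hD d hd).ne, hdW⟩
    · obtain ⟨s, hs, hsT⟩ := hmeet W hW hWV
      -- If d above u were in another block W, that block would reach some s in T, and u < d < t < s
      -- would be a crossing of V and W.
      exact absurd (hP.noncrossing V hV W hW u d t s hud (hD d hd) (hT s hsT)
        (Finset.mem_of_mem_erase hu) htV hdW hs).symm hWV
  · rw [mem_ncPartitions]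
    refine ⟨⟨?_, ?_, ?_, ?_, ?_⟩, ?_⟩
    · exact fun W hW => hP.nonempty W (Finset.mem_of_mem_erase hW)
    · intro W hW w hw
      obtain ⟨hWV, hW⟩ := Finset.mem_erase.1 hW
      have h1 := hP.subset W hW hw
      have h2 : w ∉ V := fun h => hWV (hP.eq_of_mem W hW V hV w hw h)
      have h3 : w ≠ t := fun h => h2 (h ▸ htV)
      simp only [Finset.mem_union, Finset.mem_insert, Finset.mem_sdiff, Finset.mem_erase] at *
      tauto
    · intro a ha
      obtain ⟨W, hW, haW⟩ := hP.cover a (by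
        simp only [Finset.mem_union, Finset.mem_insert, Finset.mem_sdiff] at *
        tauto)
      refine ⟨W, Finset.mem_erase.2 ⟨?_, hW⟩, haW⟩
      rintro rfl
      simp only [Finset.mem_union, Finset.mem_sdiff, Finset.mem_erase] at ha
      rcases ha with ha | ha
      · exact ha.2 ⟨(hD a ha.1).ne, haW⟩
      · exact hVT a haW ha
    · exact fun W hW W' hW' => hP.eq_of_mem W (Finset.mem_of_mem_erase hW) W'
        (Finset.mem_of_mem_erase hW')
    · exact fun W hW W' hW' => hP.noncrossing W (Finset.mem_of_mem_erase hW) W'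
        (Finset.mem_of_mem_erase hW')
    · exact fun W hW => hmeet W (Finset.mem_of_mem_erase hW) (Finset.ne_of_mem_erase hW)

/-- Summing over the block of the least element `t` of `insert t T` when it does not meet `T`. -/
theorem sum_ncPartitions_closing (c : ℕ → R) {D T : Finset α} {t : α} (hD : ∀ d ∈ D, d < t)
    (hT : ∀ s ∈ T, t < s) :
    ∑ P ∈ ncPartitions D (insert t T) with ¬ ∀ V ∈ P, ∃ s ∈ V, s ∈ T, ∏ V ∈ P, c V.card =
      ∑ U ∈ upperSubsets D, c (U.card + 1) *
        ∑ P ∈ ncPartitions (D \ U) T, ∏ V ∈ P, c V.card := by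
  classical
  simp_rw [Finset.mul_sum]
  rw [Finset.sum_sigma']
  have htU : ∀ U ∈ upperSubsets D, t ∉ U := by
    intro U hU htU
    simp only [upperSubsets, Finset.mem_filter, Finset.mem_powerset] at hU
    exact lt_irrefl _ (hD t (hU.1 htU))
  have hnot : ∀ U ∈ upperSubsets D, ∀ P ∈ ncPartitions (D \ U) T, ∀ W ∈ P, t ∉ W := by
    intro U _ P hP W hW htW
    rw [mem_ncPartitions] at hP
    have := hP.1.subset W hW htW
    simp only [Finset.mem_union, Finset.mem_sdiff] at this
    rcases this with h | h
    · exact lt_irrefl _ (hD t h.1)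
    · exact lt_irrefl _ (hT t h)
  symm
  refine Finset.sum_bij (fun p _ => insert (insert t p.1) p.2) ?_ ?_ ?_ ?_
  · rintro ⟨U, P⟩ h
    rw [Finset.mem_sigma] at h
    refine Finset.mem_filter.2 ⟨insert_mem_ncPartitions hD hT h.1 h.2, ?_⟩
    intro hall
    obtain ⟨s, hs, hsT⟩ := hall _ (Finset.mem_insert_self _ _)
    rcases Finset.mem_insert.1 hs with rfl | hs
    · exact lt_irrefl _ (hT _ hsT)
    · have hU := h.1
      simp only [upperSubsets, Finset.mem_filter, Finset.mem_powerset] at hU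
      exact lt_asymm (hT _ hsT) (hD _ (hU.1 hs))
  · rintro ⟨U, P⟩ h ⟨U', P'⟩ h' heq
    rw [Finset.mem_sigma] at h h'
    dsimp only at h h' heq
    have h1 : insert t U = insert t U' := by
      have : insert t U ∈ insert (insert t U') P' := heq ▸ Finset.mem_insert_self _ _
      rcases Finset.mem_insert.1 this with h1 | h1
      · exact h1
      · exact absurd (Finset.mem_insert_self t U) (hnot _ h'.1 _ h'.2 _ h1)
    have h2 : U = U' := by
      rw [← Finset.erase_insert (htU U h.1), h1, Finset.erase_insert (htU U' h'.1)]
    subst h2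
    have h3 : P = P' := by
      rw [← Finset.erase_insert (fun hm => hnot _ h.1 _ h.2 _ hm (Finset.mem_insert_self t U)),
        heq, Finset.erase_insert
          (fun hm => hnot _ h'.1 _ h'.2 _ hm (Finset.mem_insert_self t U))]
    rw [h3]
  · intro P hP
    obtain ⟨hP, hex⟩ := Finset.mem_filter.1 hP
    push Not at hex
    obtain ⟨V, hV, hVT⟩ := hex
    have htV : t ∈ V := by
      obtain ⟨s, hs, hsT⟩ := (mem_ncPartitions.1 hP).2 V hV
      rcases Finset.mem_insert.1 hsT with rfl | hsT
      · exact hs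
      · exact absurd hsT (hVT s hs)
    obtain ⟨h1, h2⟩ := erase_mem_ncPartitions hD hT hP hV htV hVT
    refine ⟨⟨V.erase t, P.erase V⟩, Finset.mem_sigma.2 ⟨h1, h2⟩, ?_⟩
    simp only [Finset.insert_erase htV, Finset.insert_erase hV]
  · rintro ⟨U, P⟩ h
    rw [Finset.mem_sigma] at h
    rw [Finset.prod_insert (fun hm => hnot _ h.1 _ h.2 _ hm (Finset.mem_insert_self t U)),
      Finset.card_insert_of_notMem (htU U h.1)]

/-- D holds the open points already scanned and T the points to come. The least point of T either
stays open or closes a block with the top k points of D, which is the recursion of `stackMoment`. -/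
theorem sum_ncPartitions (c : ℕ → R) (T : Finset α) : ∀ D : Finset α,
    (∀ d ∈ D, ∀ t ∈ T, d < t) →
    ∑ P ∈ ncPartitions D T, ∏ V ∈ P, c V.card = stackMoment c T.card D.card := by
  classical
  induction T using Finset.induction_on_min with
  | empty =>
    intro D _
    rw [Finset.card_empty, stackMoment]
    by_cases hD : D = ∅
    · subst hD
      have : ncPartitions (∅ : Finset α) ∅ = {∅} := by
        ext P
        rw [mem_ncPartitions, Finset.mem_singleton]
        constructor
        · rintro ⟨-, h⟩
          refine Finset.eq_empty_of_forall_notMem fun V hV => ?_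
          obtain ⟨t, -, ht⟩ := h V hV
          exact absurd ht (Finset.notMem_empty t)
        · rintro rfl
          exact ⟨⟨by simp, by simp, by simp, by simp, by simp⟩, by simp⟩
      simp [this]
    · have : ncPartitions D ∅ = ∅ := by
        refine Finset.eq_empty_of_forall_notMem fun P hP => ?_
        rw [mem_ncPartitions] at hP
        obtain ⟨d, hd⟩ := Finset.nonempty_iff_ne_empty.2 hD
        obtain ⟨V, hV, -⟩ := hP.1.cover d (Finset.mem_union_left _ hd)
        obtain ⟨t, -, ht⟩ := hP.2 V hV
        exact absurd ht (Finset.notMem_empty t)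
      simp [this, hD]
  | insert t T ht ih =>
    intro D hD
    have htT : t ∉ T := fun h => lt_irrefl _ (ht t h)
    have hDt : ∀ d ∈ D, d < t := fun d hd => hD d hd t (Finset.mem_insert_self _ _)
    have htD : t ∉ D := fun h => lt_irrefl _ (hDt t h)
    rw [← Finset.sum_filter_add_sum_filter_not _ (fun P => ∀ V ∈ P, ∃ s ∈ V, s ∈ T),
      sum_ncPartitions_closing c hDt ht, Finset.card_insert_of_notMem htT, stackMoment]
    congr 1
    · rw [← Finset.card_insert_of_notMem htD, ← ih (insert t D)]
      · refine Finset.sum_congr ?_ (fun _ _ => rfl)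
        ext P
        rw [Finset.mem_filter, ncPartitions_insert_of_isMin]
      · intro d hd s hs
        rcases Finset.mem_insert.1 hd with rfl | hd
        · exact ht s hs
        · exact (hDt d hd).trans (ht s hs)
    · rw [← sum_upperSubsets D (fun k => c (k + 1) * stackMoment c T.card (D.card - k))]
      refine Finset.sum_congr rfl fun U hU => ?_
      have hUD : U ⊆ D := by
        simp only [upperSubsets, Finset.mem_filter, Finset.mem_powerset] at hU
        exact hU.1
      rw [ih (D \ U), Finset.card_sdiff_of_subset hUD]
      exact fun d hd s hs => (hDt d (Finset.mem_sdiff.1 hd).1).trans (ht s hs)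

end Combinatorics

/-! ### Refinements of a non-crossing partition, block by block. -/

section Multiplicativity

variable {α : Type*} [LinearOrder α] {R : Type*} [CommRing R]

theorem sum_ncPartitions_empty (c : ℕ → R) (V : Finset α) :
    ∑ P ∈ ncPartitions ∅ V, ∏ W ∈ P, c W.card = stackMoment c V.card 0 := by
  simpa using sum_ncPartitions c V ∅ (by simp)

theorem IsNCPartition.restrict {S V : Finset α} {P Q : Finset (Finset α)}
    (hQ : IsNCPartition S Q) (hP : IsNCPartition S P) (hPQ : ∀ W ∈ P, ∃ V ∈ Q, W ⊆ V)
    (hV : V ∈ Q) : IsNCPartition V (P.filter (· ⊆ V)) := by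
  refine ⟨fun W hW => hP.nonempty W (Finset.mem_of_mem_filter W hW),
    fun W hW => (Finset.mem_filter.1 hW).2, fun a ha => ?_,
    fun W hW W' hW' => hP.eq_of_mem W (Finset.mem_of_mem_filter W hW) W'
      (Finset.mem_of_mem_filter W' hW'),
    fun W hW W' hW' => hP.noncrossing W (Finset.mem_of_mem_filter W hW) W'
      (Finset.mem_of_mem_filter W' hW')⟩
  obtain ⟨W, hW, haW⟩ := hP.cover a (hQ.subset V hV ha)
  obtain ⟨V', hV', hWV'⟩ := hPQ W hW
  have : V' = V := hQ.eq_of_mem V' hV' V hV a (hWV' haW) ha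
  exact ⟨W, Finset.mem_filter.2 ⟨hW, this ▸ hWV'⟩, haW⟩

theorem IsNCPartition.biUnion {S : Finset α} {Q : Finset (Finset α)} (hQ : IsNCPartition S Q)
    (p : ∀ V ∈ Q, Finset (Finset α)) (hp : ∀ V (hV : V ∈ Q), IsNCPartition V (p V hV)) :
    IsNCPartition S (Q.attach.biUnion fun V => p V.1 V.2) := by
  have hmem : ∀ W, W ∈ (Q.attach.biUnion fun V => p V.1 V.2) ↔ ∃ V, ∃ hV : V ∈ Q, W ∈ p V hV := by
    intro W
    simp
  refine ⟨?_, ?_, ?_, ?_, ?_⟩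
  · intro W hW
    obtain ⟨V, hV, hW⟩ := (hmem W).1 hW
    exact (hp V hV).nonempty W hW
  · intro W hW
    obtain ⟨V, hV, hW⟩ := (hmem W).1 hW
    exact ((hp V hV).subset W hW).trans (hQ.subset V hV)
  · intro a ha
    obtain ⟨V, hV, haV⟩ := hQ.cover a ha
    obtain ⟨W, hW, haW⟩ := (hp V hV).cover a haV
    exact ⟨W, (hmem W).2 ⟨V, hV, hW⟩, haW⟩
  · intro W hW W' hW' a ha ha'
    obtain ⟨V, hV, hW⟩ := (hmem W).1 hW
    obtain ⟨V', hV', hW'⟩ := (hmem W').1 hW'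
    obtain rfl := hQ.eq_of_mem V hV V' hV' a ((hp V hV).subset W hW ha)
      ((hp V' hV').subset W' hW' ha')
    exact (hp V hV).eq_of_mem W hW W' hW' a ha ha'
  · intro W hW W' hW' i j k l hij hjk hkl hi hk hj hl
    obtain ⟨V, hV, hW⟩ := (hmem W).1 hW
    obtain ⟨V', hV', hW'⟩ := (hmem W').1 hW'
    -- Crossing pieces of V and V' would make V and V' cross, so only one block of Q is involved.
    obtain rfl := hQ.noncrossing V hV V' hV' i j k l hij hjk hkl ((hp V hV).subset W hW hi)
      ((hp V hV).subset W hW hk) ((hp V' hV').subset W' hW' hj) ((hp V' hV').subset W' hW' hl)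
    exact (hp V hV).noncrossing W hW W' hW' i j k l hij hjk hkl hi hk hj hl

/-- The sum over the non-crossing refinements of `Q` factors over the blocks of `Q`. -/
theorem sum_refinements (c : ℕ → R) {S : Finset α} {Q : Finset (Finset α)}
    [DecidablePred fun P : Finset (Finset α) => ∀ W ∈ P, ∃ V ∈ Q, W ⊆ V]
    (hQ : IsNCPartition S Q) :
    ∑ P ∈ ncPartitions ∅ S with ∀ W ∈ P, ∃ V ∈ Q, W ⊆ V, ∏ W ∈ P, c W.card =
      ∏ V ∈ Q, stackMoment c V.card 0 := by
  simp_rw [← sum_ncPartitions_empty]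
  rw [Finset.prod_sum]
  have hdisj : ∀ (p : ∀ V ∈ Q, Finset (Finset α)), (∀ V (hV : V ∈ Q), IsNCPartition V (p V hV)) →
      ∀ V (hV : V ∈ Q) V' (hV' : V' ∈ Q) W, W ∈ p V hV → W ⊆ V' → V = V' := by
    intro p hp V hV V' hV' W hW hW'
    obtain ⟨a, ha⟩ := (hp V hV).nonempty W hW
    exact hQ.eq_of_mem V hV V' hV' a ((hp V hV).subset W hW ha) (hW' ha)
  have hpi : ∀ p ∈ Q.pi fun V => ncPartitions ∅ V, ∀ V (hV : V ∈ Q), IsNCPartition V (p V hV) :=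
    fun p hp V hV => mem_ncPartitions_empty.1 (Finset.mem_pi.1 hp V hV)
  symm
  refine Finset.sum_bij' (fun p _ => Q.attach.biUnion fun V => p V.1 V.2)
    (fun P _ V _ => P.filter (· ⊆ V)) ?_ ?_ ?_ ?_ ?_
  · intro p hp
    refine Finset.mem_filter.2 ⟨mem_ncPartitions_empty.2 (hQ.biUnion p (hpi p hp)), ?_⟩
    intro W hW
    obtain ⟨V, -, hW⟩ := Finset.mem_biUnion.1 hW
    exact ⟨V.1, V.2, (hpi p hp V.1 V.2).subset W hW⟩
  · intro P hP
    obtain ⟨hP, hPQ⟩ := Finset.mem_filter.1 hP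
    exact Finset.mem_pi.2 fun V hV => mem_ncPartitions_empty.2
      (hQ.restrict (mem_ncPartitions_empty.1 hP) hPQ hV)
  · intro p hp
    funext V hV
    ext W
    simp only [Finset.mem_filter, Finset.mem_biUnion, Finset.mem_attach, true_and, Subtype.exists]
    constructor
    · rintro ⟨⟨V', hV', hW⟩, hWV⟩
      obtain rfl := hdisj p (hpi p hp) V' hV' V hV W hW hWV
      exact hW
    · exact fun hW => ⟨⟨V, hV, hW⟩, (hpi p hp V hV).subset W hW⟩
  · intro P hP
    obtain ⟨-, hPQ⟩ := Finset.mem_filter.1 hP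
    ext W
    simp only [Finset.mem_filter, Finset.mem_biUnion, Finset.mem_attach, true_and, Subtype.exists]
    constructor
    · rintro ⟨V', hV', hW, -⟩
      exact hW
    · intro hW
      obtain ⟨V, hV, hWV⟩ := hPQ W hW
      exact ⟨V, hV, hW, hWV⟩
  · intro p hp
    rw [Finset.prod_biUnion]
    intro V _ V' _ hVV'
    refine Finset.disjoint_left.2 fun W hW hW' => hVV' (Subtype.ext ?_)
    exact hdisj p (hpi p hp) V.1 V.2 V'.1 V'.2 W hW ((hpi p hp V'.1 V'.2).subset W hW')

end Multiplicativity

/-! ### Möbius inversion between moments and free cumulants. -/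

section Moebius

variable {R : Type*} [CommRing R]

theorem NC.isNCPartition {n : ℕ} (π : NC n) : IsNCPartition Finset.univ π.1.parts :=
  ⟨fun _ hV => π.1.nonempty_of_mem_parts hV, fun V _ => Finset.subset_univ V,
    fun _ ha => π.1.exists_mem ha,
    fun _ hV _ hW _ ha hb => π.1.eq_of_mem_parts hV hW ha hb, π.2⟩

theorem IsNCPartition.exists_NC {n : ℕ} {P : Finset (Finset (Fin n))}
    (hP : IsNCPartition Finset.univ P) : ∃ π : NC n, π.1.parts = P := by
  have hind : P.SupIndep id := by
    rw [Finset.supIndep_iff_pairwiseDisjoint]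
    intro V hV W hW hVW
    exact Finset.disjoint_left.2 fun a ha hb => hVW (hP.eq_of_mem V hV W hW a ha hb)
  refine ⟨⟨⟨P, hind, ?_, ?_⟩, hP.noncrossing⟩, rfl⟩
  · refine Finset.eq_univ_of_forall fun a => ?_
    obtain ⟨V, hV, ha⟩ := hP.cover a (Finset.mem_univ a)
    exact Finset.mem_sup.2 ⟨V, hV, ha⟩
  · exact fun h => Finset.not_nonempty_empty (hP.nonempty _ h)

theorem sum_Iic_NC (c : ℕ → R) {n : ℕ} (π : NC n) [DecidableRel (α := NC n) (· ≤ ·)] :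
    ∑ σ : NC n with σ ≤ π, ∏ W ∈ σ.1.parts, c W.card =
      ∏ V ∈ π.1.parts, stackMoment c V.card 0 := by
  rw [← sum_refinements c π.isNCPartition]
  refine Finset.sum_nbij (fun σ => σ.1.parts) ?_ ?_ ?_ (fun _ _ => rfl)
  · intro σ hσ
    rw [Finset.mem_filter]
    refine ⟨mem_ncPartitions_empty.2 σ.isNCPartition, fun W hW => ?_⟩
    exact (Finset.mem_filter.1 hσ).2 hW
  · intro σ _ τ _ h
    exact Subtype.ext (Finpartition.ext h)
  · intro P hP
    rw [Finset.mem_coe, Finset.mem_filter] at hP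
    obtain ⟨σ, rfl⟩ := (mem_ncPartitions_empty.1 hP.1).exists_NC
    refine ⟨σ, Finset.mem_coe.2 (Finset.mem_filter.2 ⟨Finset.mem_univ _, ?_⟩), rfl⟩
    exact fun W hW => hP.2 W hW

theorem NC.le_one {n : ℕ} (π : NC n) : π ≤ NC.one n := by
  change π.1 ≤ ⊤
  exact le_top

theorem NC.parts_one {n : ℕ} (hn : 1 ≤ n) : (NC.one n).1.parts = {Finset.univ} := by
  have : Nonempty (Fin n) := ⟨⟨0, hn⟩⟩
  refine (Finset.subset_singleton_iff.1
    (Finpartition.parts_top_subset (Finset.univ : Finset (Fin n)))).resolve_left fun h => ?_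
  obtain ⟨V, hV, -⟩ := (NC.one n).isNCPartition.cover ⟨0, hn⟩ (Finset.mem_univ _)
  exact Finset.notMem_empty V (h ▸ hV)

theorem NC.card_lt {n : ℕ} {π : NC n} (hπ : π ≠ NC.one n) {V : Finset (Fin n)}
    (hV : V ∈ π.1.parts) : V.card < n := by
  by_contra hcard
  have hVu : V = Finset.univ := by
    refine Finset.eq_univ_of_card V (le_antisymm (Finset.card_le_univ V) ?_)
    simpa using hcard
  refine hπ (le_antisymm π.le_one ?_)
  intro W hW
  exact ⟨V, hV, hVu ▸ Finset.subset_univ W⟩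

variable [Algebra ℂ R]

/-- The free cumulants of a sequence of moments. -/
noncomputable def cumulantSeq (μ : ℕ → R) (n : ℕ) : R :=
  ∑ π : NC n, algebraMap ℂ R (moebOne π) * ∏ V ∈ π.1.parts, μ V.card

theorem sum_moebOne {n : ℕ} (σ : NC n) [DecidableRel (α := NC n) (· ≤ ·)]  :
    ∑ π : NC n with σ ≤ π, moebOne π = if σ = NC.one n then 1 else 0 := by
  classical
  rw [← IncidenceAlgebra.sum_Icc_mu_left (𝕜 := ℂ) σ (NC.one n)]
  refine Finset.sum_congr ?_ (fun _ _ => rfl)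
  ext π
  simp [NC.le_one]

/-- Each product of moments over the blocks of π expands into a sum over σ ≤ π. After exchanging the
sums, the Möbius function leaves only σ = 1_n. -/
theorem cumulantSeq_stackMoment (c : ℕ → R) {n : ℕ} (hn : 1 ≤ n) :
    cumulantSeq (fun a => stackMoment c a 0) n = c n := by
  classical
  have h : ∀ π : NC n, algebraMap ℂ R (moebOne π) * ∏ V ∈ π.1.parts, stackMoment c V.card 0 =
      ∑ σ : NC n, if σ ≤ π then algebraMap ℂ R (moebOne π) * ∏ W ∈ σ.1.parts, c W.card else 0 := by
    intro π
    rw [← sum_Iic_NC, Finset.mul_sum, Finset.sum_filter]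
  rw [cumulantSeq, Finset.sum_congr rfl fun π _ => h π, Finset.sum_comm]
  have h2 : ∀ σ : NC n, (∑ π : NC n, if σ ≤ π then
      algebraMap ℂ R (moebOne π) * ∏ W ∈ σ.1.parts, c W.card else 0) =
      if σ = NC.one n then ∏ W ∈ σ.1.parts, c W.card else 0 := by
    intro σ
    rw [← Finset.sum_filter, ← Finset.sum_mul, ← map_sum, sum_moebOne]
    split_ifs <;> simp
  rw [Finset.sum_congr rfl fun σ _ => h2 σ, Finset.sum_ite_eq' Finset.univ (NC.one n),
    if_pos (Finset.mem_univ _), NC.parts_one hn]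
  simp

theorem moebOne_one (n : ℕ) : moebOne (NC.one n) = 1 := by
  classical
  exact IncidenceAlgebra.mu_self _

/-- The moment of order n occurs in the n-th cumulant only through 1_n, with coefficient 1; every
other partition has blocks smaller than n, so strong induction applies. -/
theorem eq_of_cumulantSeq_eq {μ ν : ℕ → R} (h : ∀ n, 1 ≤ n → cumulantSeq μ n = cumulantSeq ν n)
    (n : ℕ) (hn : 1 ≤ n) : μ n = ν n := by
  classical
  induction n using Nat.strong_induction_on with
  | _ n ih =>
    have key := h n hn
    rw [cumulantSeq, cumulantSeq, ← Finset.add_sum_erase _ _ (Finset.mem_univ (NC.one n)),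
      ← Finset.add_sum_erase _ _ (Finset.mem_univ (NC.one n)), moebOne_one, NC.parts_one hn] at key
    have herase : ∑ π ∈ Finset.univ.erase (NC.one n),
        algebraMap ℂ R (moebOne π) * ∏ V ∈ π.1.parts, μ V.card =
        ∑ π ∈ Finset.univ.erase (NC.one n),
        algebraMap ℂ R (moebOne π) * ∏ V ∈ π.1.parts, ν V.card := by
      refine Finset.sum_congr rfl fun π hπ => ?_
      congr 1
      refine Finset.prod_congr rfl fun V hV => ?_
      exact ih _ (NC.card_lt (Finset.ne_of_mem_erase hπ) hV)
        (Finset.card_pos.2 (π.1.nonempty_of_mem_parts hV))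
    rw [herase] at key
    simpa using key

end Moebius

/-! ### Moments read off from polynomials with vanishing expectation. -/

section Orthogonal

variable {R : Type*} [CommRing R] {A : Type*} [Ring A] [Algebra R A]

/-- The elements `q n` are the polynomials in `y` mapping the vacuum to the `n`-particle vector
in the Fock space model for the free cumulants `c`. -/
structure IsFockSeq (c : ℕ → R) (y : A) (q : ℕ → A) : Prop where
  zero : q 0 = 1
  succ : ∀ n, q (n + 1) = y * q n - ∑ k ∈ Finset.range (n + 1), c (k + 1) • q (n - k)

variable {c : ℕ → R} {y : A} {q : ℕ → A} (Φ : A →ₗ[R] R)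

/-- Solving the recursion for y * q n reproduces the recursion of `stackMoment`, and the vanishing
of Φ on q n for n ≥ 1 is its initial row. -/
theorem IsFockSeq.map_pow_mul (hq : IsFockSeq c y q) (h1 : Φ 1 = 1)
    (h0 : ∀ n, 1 ≤ n → Φ (q n) = 0) (a : ℕ) : ∀ n, Φ (y ^ a * q n) = stackMoment c a n := by
  induction a with
  | zero =>
    intro n
    rw [pow_zero, one_mul, stackMoment]
    split_ifs with hn
    · rw [hn, hq.zero, h1]
    · exact h0 n (Nat.one_le_iff_ne_zero.2 hn)
  | succ a ih =>
    intro n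
    have h : y * q n = q (n + 1) + ∑ k ∈ Finset.range (n + 1), c (k + 1) • q (n - k) := by
      rw [hq.succ]; abel
    rw [pow_succ, mul_assoc, h, mul_add, Finset.mul_sum, map_add, map_sum, ih, stackMoment]
    simp [ih]

theorem IsFockSeq.map_pow (hq : IsFockSeq c y q) (h1 : Φ 1 = 1)
    (h0 : ∀ n, 1 ≤ n → Φ (q n) = 0) (a : ℕ) : Φ (y ^ a) = stackMoment c a 0 := by
  rw [← hq.map_pow_mul Φ h1 h0 a 0, hq.zero, mul_one]

/-- Converse of `IsFockSeq.map_pow`: the same recursion run in n instead of a, then evaluated at a =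
0. -/
theorem IsFockSeq.map_eq_zero (hq : IsFockSeq c y q) (h : ∀ a, Φ (y ^ a) = stackMoment c a 0)
    (n : ℕ) (hn : 1 ≤ n) : Φ (q n) = 0 := by
  have key : ∀ n a, Φ (y ^ a * q n) = stackMoment c a n := by
    intro n
    induction n using Nat.strong_induction_on with
    | _ n ih =>
      intro a
      cases n with
      | zero => rw [hq.zero, mul_one, h]
      | succ n =>
        rw [hq.succ, mul_sub, ← mul_assoc, ← pow_succ, map_sub, Finset.mul_sum, map_sum,
          ih n (Nat.lt_succ_self n), stackMoment, sub_eq_iff_eq_add]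
        congr 1
        refine Finset.sum_congr rfl fun k _ => ?_
        rw [mul_smul_comm, map_smul, ih (n - k) (by omega), smul_eq_mul]
  simpa [stackMoment, Nat.one_le_iff_ne_zero.1 hn] using key n 0

end Orthogonal

/-! ### Freeness over a commutative ring. -/

section Free

variable {R : Type*} [CommRing R] {A : Type*} [Ring A] [Algebra R A] {ι : Type*}

/-- `l` is an alternating word of centred elements of the subalgebras `B i`. -/
def IsCentredWord (Φ : A →ₗ[R] R) (B : ι → Subalgebra R A) (l : List (ι × A)) : Prop :=
  l.IsChain (fun p q => p.1 ≠ q.1) ∧ ∀ p ∈ l, p.2 ∈ B p.1 ∧ Φ p.2 = 0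

/-- Freeness of a family of subalgebras over a commutative ring. -/
def IsFreeFamily (Φ : A →ₗ[R] R) (B : ι → Subalgebra R A) : Prop :=
  ∀ l : List (ι × A), l ≠ [] → IsCentredWord Φ B l → Φ (l.map Prod.snd).prod = 0

/-- The span of the alternating centred words whose first letter has index `i`. -/
def centredSpan (Φ : A →ₗ[R] R) (B : ι → Subalgebra R A) (i : ι) : Submodule R A :=
  Submodule.span R {z | ∃ a l, IsCentredWord Φ B ((i, a) :: l) ∧
    z = (((i, a) :: l).map Prod.snd).prod}

variable {Φ : A →ₗ[R] R} {B : ι → Subalgebra R A}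

theorem mem_centredSpan {i : ι} {a : A} (ha : a ∈ B i) (h0 : Φ a = 0) :
    a ∈ centredSpan Φ B i := by
  refine Submodule.subset_span ⟨a, [], ⟨List.isChain_singleton _, ?_⟩, by simp⟩
  simp [ha, h0]

theorem mul_mem_centredSpan {i j : ι} (hij : i ≠ j) {a z : A} (ha : a ∈ B i) (h0 : Φ a = 0)
    (hz : z ∈ centredSpan Φ B j) : a * z ∈ centredSpan Φ B i := by
  induction hz using Submodule.span_induction with
  | mem z hz =>
    obtain ⟨b, l, hl, rfl⟩ := hz
    refine Submodule.subset_span ⟨a, (j, b) :: l, ⟨?_, ?_⟩, by simp⟩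
    · exact List.isChain_cons_cons.2 ⟨hij, hl.1⟩
    · intro p hp
      rcases List.mem_cons.1 hp with rfl | hp
      · exact ⟨ha, h0⟩
      · exact hl.2 p hp
  | zero => simp
  | add z w _ _ hz hw => rw [mul_add]; exact add_mem hz hw
  | smul r z _ hz => rw [mul_smul_comm]; exact Submodule.smul_mem _ _ hz

theorem IsFreeFamily.map_centredSpan (hfree : IsFreeFamily Φ B) {i : ι} {z : A}
    (hz : z ∈ centredSpan Φ B i) : Φ z = 0 := by
  induction hz using Submodule.span_induction with
  | mem z hz =>
    obtain ⟨b, l, hl, rfl⟩ := hz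
    exact hfree _ (List.cons_ne_nil _ _) hl
  | zero => simp
  | add z w _ _ hz hw => rw [map_add, hz, hw, add_zero]
  | smul r z _ hz => rw [map_smul, hz, smul_zero]

end Free

/-! ### Wick products of a semicircular element. -/

section Wick

variable {R : Type*} [CommRing R] {A : Type*} [Ring A] [Algebra R A]

/-- Chebyshev polynomials of the second kind in `s`, of variance `v`. -/
def cheb (s : A) (v : R) : ℕ → A
  | 0 => 1
  | 1 => s
  | n + 2 => s * cheb s v (n + 1) - v • cheb s v n

/-- `wick Φ s v k [b₁, …, bₙ]` is the Wick product `s ⋯ s b₁ s b₂ ⋯ s bₙ` beginning with `k + 1`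
letters `s`, and `wick Φ s v k []` is the Wick product of `k` letters `s`. -/
def wick (Φ : A →ₗ[R] R) (s : A) (v : R) : ℕ → List A → A
  | k, [] => cheb s v k
  | k, b :: l => cheb s v (k + 1) * (b - algebraMap R A (Φ b)) * wick Φ s v 0 l +
      Φ b • wick Φ s v (k + 1) l

variable {Φ : A →ₗ[R] R} {s : A} {v : R}

theorem wick_add_two (k : ℕ) (l : List A) :
    wick Φ s v (k + 2) l = s * wick Φ s v (k + 1) l - v • wick Φ s v k l := by
  induction l generalizing k with
  | nil => rfl
  | cons b l ih =>
    simp only [wick, ih, cheb]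
    simp only [sub_mul, mul_sub, mul_add, mul_assoc, smul_mul_assoc, smul_sub, smul_add,
      mul_smul_comm, smul_comm (Φ b) v]
    abel

theorem wick_one_cons (b : A) (l : List A) :
    wick Φ s v 1 (b :: l) = s * wick Φ s v 0 (b :: l) - v • (b * wick Φ s v 0 l) := by
  have h := wick_add_two (Φ := Φ) (s := s) (v := v) 0 l
  simp only [wick, cheb, zero_add] at h ⊢
  rw [h]
  simp only [sub_mul, mul_sub, mul_add, mul_assoc, smul_mul_assoc, smul_sub,
    mul_smul_comm, smul_comm (Φ b) v, Algebra.algebraMap_eq_smul_one, one_mul, mul_one]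
  abel

/-- The centring of b disappears: Φ b survives only in the contraction of the two letters s around
b. This is the usual Wick recursion. -/
theorem wick_cons_cons (b c : A) (l : List A) :
    wick Φ s v 0 (b :: c :: l) =
      s * b * wick Φ s v 0 (c :: l) - (v * Φ b) • (c * wick Φ s v 0 l) := by
  rw [wick, zero_add, wick_one_cons]
  simp only [cheb, sub_mul, mul_sub, mul_assoc, smul_mul_assoc, smul_sub,
    mul_smul_comm, Algebra.algebraMap_eq_smul_one, one_mul, smul_smul, mul_comm v]
  abel

theorem wick_singleton (b : A) : wick Φ s v 0 [b] = s * b := by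
  simp [wick, cheb, mul_sub, Algebra.algebraMap_eq_smul_one]

theorem wick_one_first (h1 : Φ 1 = 1) (k : ℕ) (l : List A) :
    wick Φ s v k (1 :: l) = wick Φ s v (k + 1) l := by
  simp [wick, h1]

theorem cheb_mem (S : Subalgebra R A) (hs : s ∈ S) : ∀ n, cheb s v n ∈ S
  | 0 => S.one_mem
  | 1 => hs
  | n + 2 => S.sub_mem (S.mul_mem hs (cheb_mem S hs (n + 1))) (S.smul_mem (cheb_mem S hs n) v)

variable {ι : Type*} {B : ι → Subalgebra R A}

/-- Splitting each b into its centred part and Φ b, as the recursion for `wick` does, gives words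
alternating between Chebyshev polynomials of positive degree and centred b. The empty product `wick
Φ s v 0 []` is 1 and must be excluded. -/
theorem wick_mem_centredSpan (h1 : Φ 1 = 1) {i j : ι} (hij : i ≠ j) (hs : s ∈ B j)
    (hU : ∀ n, 1 ≤ n → Φ (cheb s v n) = 0) (l : List A) (hl : ∀ b ∈ l, b ∈ B i) :
    (∀ k, wick Φ s v (k + 1) l ∈ centredSpan Φ B j) ∧
      (l ≠ [] → wick Φ s v 0 l ∈ centredSpan Φ B j) := by
  induction l with
  | nil => exact ⟨fun k => mem_centredSpan (cheb_mem _ hs _) (hU _ (by omega)), by simp⟩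
  | cons b l ih =>
    have ih := ih fun c hc => hl c (List.mem_cons_of_mem _ hc)
    have hb : b - algebraMap R A (Φ b) ∈ B i :=
      (B i).sub_mem (hl b List.mem_cons_self) ((B i).algebraMap_mem _)
    have hb0 : Φ (b - algebraMap R A (Φ b)) = 0 := by
      simp [Algebra.algebraMap_eq_smul_one, h1]
    have key : ∀ k, wick Φ s v k (b :: l) ∈ centredSpan Φ B j := by
      intro k
      rw [wick]
      refine add_mem ?_ (Submodule.smul_mem _ _ (ih.1 k))
      rw [mul_assoc]
      refine mul_mem_centredSpan hij.symm (cheb_mem _ hs _) (hU _ (by omega)) ?_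
      cases l with
      | nil => simpa [wick, cheb] using mem_centredSpan hb hb0
      | cons c l => exact mul_mem_centredSpan hij hb hb0 (ih.2 (List.cons_ne_nil _ _))
    exact ⟨fun k => key (k + 1), fun _ => key 0⟩

/-- The span of the Wick products, with coefficients in `S`, whose number of letters `s` is even
(if `p` holds) or odd (otherwise). -/
def wickSpan (Φ : A →ₗ[R] R) (s : A) (v : R) (S : Subalgebra R A) (p : Prop) : Submodule R A :=
  Submodule.span R {z | ∃ b ∈ S, ∃ l : List A, (∀ c ∈ l, c ∈ S) ∧ (Even l.length ↔ p) ∧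
    z = b * wick Φ s v 0 l}

theorem map_wickSpan_false (h1 : Φ 1 = 1) (hfree : IsFreeFamily Φ B) {i j : ι} (hij : i ≠ j)
    (hs : s ∈ B j) (hU : ∀ n, 1 ≤ n → Φ (cheb s v n) = 0) {z : A}
    (hz : z ∈ wickSpan Φ s v (B i) False) : Φ z = 0 := by
  induction hz using Submodule.span_induction with
  | mem z hz =>
    obtain ⟨b, hb, l, hl, heven, rfl⟩ := hz
    -- Odd length rules out the empty list, whose Wick product 1 is not killed by Φ.
    have hne : l ≠ [] := by
      rintro rfl
      simp at heven
    have h := (wick_mem_centredSpan h1 hij hs hU l hl).2 hne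
    have hb' : b - algebraMap R A (Φ b) ∈ B i := (B i).sub_mem hb ((B i).algebraMap_mem _)
    have hb0 : Φ (b - algebraMap R A (Φ b)) = 0 := by
      simp [Algebra.algebraMap_eq_smul_one, h1]
    have h2 := hfree.map_centredSpan (mul_mem_centredSpan hij hb' hb0 h)
    rw [sub_mul, map_sub, ← Algebra.smul_def, map_smul, hfree.map_centredSpan h] at h2
    simpa using h2
  | zero => simp
  | add z w _ _ hz hw => rw [map_add, hz, hw, add_zero]
  | smul r z _ hz => rw [map_smul, hz, smul_zero]

variable {S : Subalgebra R A} {p : Prop}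

theorem mul_mem_wickSpan {b z : A} (hb : b ∈ S) (hz : z ∈ wickSpan Φ s v S p) :
    b * z ∈ wickSpan Φ s v S p := by
  induction hz using Submodule.span_induction with
  | mem z hz =>
    obtain ⟨c, hc, l, hl, heven, rfl⟩ := hz
    exact Submodule.subset_span ⟨b * c, S.mul_mem hb hc, l, hl, heven, by rw [mul_assoc]⟩
  | zero => simp
  | add z w _ _ hz hw => rw [mul_add]; exact add_mem hz hw
  | smul r z _ hz => rw [mul_smul_comm]; exact Submodule.smul_mem _ _ hz

/-- By the Wick recursion, s b W is a longer Wick product plus a contraction that removes two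
letters; both have the opposite parity to W. -/
theorem self_mul_mem_wickSpan {z : A} (hz : z ∈ wickSpan Φ s v S p) :
    s * z ∈ wickSpan Φ s v S (¬ p) := by
  induction hz using Submodule.span_induction with
  | mem z hz =>
    obtain ⟨b, hb, l, hl, heven, rfl⟩ := hz
    have hw : wick Φ s v 0 (b :: l) ∈ wickSpan Φ s v S (¬ p) := by
      refine Submodule.subset_span ⟨1, S.one_mem, b :: l, ?_, ?_, (one_mul _).symm⟩
      · intro c hc
        rcases List.mem_cons.1 hc with rfl | hc
        · exact hb
        · exact hl c hc
      · rw [List.length_cons, Nat.even_add_one, heven]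
    cases l with
    | nil =>
      rw [wick_singleton] at hw
      simpa [wick, cheb] using hw
    | cons c l =>
      rw [wick_cons_cons] at hw
      have h2 : c * wick Φ s v 0 l ∈ wickSpan Φ s v S (¬ p) := by
        refine Submodule.subset_span ⟨c, hl c List.mem_cons_self, l,
          fun d hd => hl d (List.mem_cons_of_mem _ hd), ?_, rfl⟩
        rw [List.length_cons, Nat.even_add_one] at heven
        tauto
      have := add_mem hw (Submodule.smul_mem _ (v * Φ b) h2)
      rwa [sub_add_cancel, mul_assoc] at this
  | zero => simp
  | add z w _ _ hz hw => rw [mul_add]; exact add_mem hz hw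
  | smul r z _ hz => rw [mul_smul_comm]; exact Submodule.smul_mem _ _ hz

end Wick

/-! ### Wick products as polynomials in the compressions. -/

section PoissonWords

variable {R : Type*} [CommRing R] {A : Type*} [Ring A] [Algebra R A] {κ : Type*} [DecidableEq κ]

/-- The polynomials in the `y i` which map the vacuum to `e_{i₁} ⊗ ⋯ ⊗ e_{iₙ}`, when `y i` is the
compression of a semicircular element of variance `v` by a projection of trace `r i`. -/
def poissonWord (r : κ → R) (v : R) (y : κ → A) : List κ → A
  | [] => 1
  | [i] => y i - algebraMap R A (v * r i)
  | i :: j :: l => (y i - algebraMap R A (v * r i)) * poissonWord r v y (j :: l) -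
      if i = j then v • (poissonWord r v y (j :: l) + (v * r i) • poissonWord r v y l) else 0

variable {Φ : A →ₗ[R] R} {s : A} {v : R} {e : κ → A}

/-- Each index contributes the two entries e i and 1, because s e_i s has two letters s. Contracting
the two neighbouring s between e_i and e_j leaves e_i e_j, which is e_i or 0; this produces the
correction term for equal indices. -/
theorem poissonWord_eq_wick (h1 : Φ 1 = 1) (he : ∀ i, e i * e i = e i)
    (horth : ∀ i j, i ≠ j → e i * e j = 0) : ∀ l : List κ,
    poissonWord (fun i => Φ (e i)) v (fun i => s * e i * s) l =
      wick Φ s v 0 (l.flatMap fun i => [e i, 1])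
  | [] => rfl
  | [i] => by
    simp only [poissonWord, List.flatMap_cons, List.flatMap_nil, List.append_nil]
    rw [wick_cons_cons, wick_singleton]
    simp [wick, cheb, Algebra.algebraMap_eq_smul_one]
  | i :: j :: l => by
    have ih1 := poissonWord_eq_wick h1 he horth (j :: l)
    have ih2 := poissonWord_eq_wick h1 he horth l
    have hfirst : ∀ i l, s * e i * wick Φ s v 0 (1 :: l.flatMap fun i => [e i, 1]) =
        wick Φ s v 0 ((i :: l).flatMap fun i => [e i, 1]) +
          (v * Φ (e i)) • wick Φ s v 0 (l.flatMap fun i => [e i, 1]) := by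
      intro i l
      simp only [List.flatMap_cons, List.cons_append, List.nil_append]
      rw [wick_cons_cons, one_mul, sub_add_cancel]
    have hone : wick Φ s v 0 (1 :: (j :: l).flatMap fun i => [e i, 1]) =
        s * wick Φ s v 0 ((j :: l).flatMap fun i => [e i, 1]) -
          v • (e j * wick Φ s v 0 (1 :: l.flatMap fun i => [e i, 1])) := by
      rw [wick_one_first h1]
      simp only [List.flatMap_cons, List.cons_append, List.nil_append, zero_add]
      rw [wick_one_cons]
    have h3 := hfirst i (j :: l)
    rw [hone, mul_sub, mul_smul_comm] at h3
    rw [poissonWord, ih1, ih2, ← sub_eq_iff_eq_add.2 h3, sub_mul, ← Algebra.smul_def]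
    have h4 : s * e i * (e j * wick Φ s v 0 (1 :: l.flatMap fun i => [e i, 1])) =
        if i = j then wick Φ s v 0 ((j :: l).flatMap fun i => [e i, 1]) +
          (v * Φ (e i)) • wick Φ s v 0 (l.flatMap fun i => [e i, 1]) else 0 := by
      split_ifs with hij
      · subst hij
        rw [← mul_assoc, mul_assoc s, he, hfirst]
      · rw [← mul_assoc, mul_assoc s, horth i j hij, mul_zero, zero_mul]
    rw [h4]
    split_ifs
    · simp only [mul_assoc]
      abel
    · simp only [mul_assoc, smul_zero]
      abel

variable {S : Subalgebra R A}

/-- To first order in m, x e_i x is s e_i s plus m times a term with one letter s. Such a term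
changes parity once, and m² = 0 prevents a second change. -/
theorem poissonWord_perturb (h1 : Φ 1 = 1) (he : ∀ i, e i * e i = e i)
    (horth : ∀ i j, i ≠ j → e i * e j = 0) (heS : ∀ i, e i ∈ S) {m : R} (hm : m * m = 0) {x : A}
    (hx : x = s + algebraMap R A m) (l : List κ) :
    ∃ o ∈ wickSpan Φ s v S False,
      poissonWord (fun i => Φ (e i)) v (fun i => x * e i * x) l =
        poissonWord (fun i => Φ (e i)) v (fun i => s * e i * s) l + m • o := by
  have heven : ∀ l, poissonWord (fun i => Φ (e i)) v (fun i => s * e i * s) l ∈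
      wickSpan Φ s v S True := by
    intro l
    rw [poissonWord_eq_wick h1 he horth]
    refine Submodule.subset_span ⟨1, S.one_mem, _, ?_, ?_, (one_mul _).symm⟩
    · intro c hc
      obtain ⟨i, -, hi⟩ := List.mem_flatMap.1 hc
      simp only [List.mem_cons, List.not_mem_nil, or_false] at hi
      rcases hi with rfl | rfl
      · exact heS i
      · exact S.one_mem
    · simp [List.length_flatMap]
  have hodd : ∀ i, ∀ z ∈ wickSpan Φ s v S True, (e i * s + s * e i) * z ∈
      wickSpan Φ s v S False := by
    intro i z hz
    rw [add_mul, mul_assoc, mul_assoc]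
    have a1 := mul_mem_wickSpan (heS i) (self_mul_mem_wickSpan hz)
    have a2 := self_mul_mem_wickSpan (mul_mem_wickSpan (heS i) hz)
    simp only [not_true_eq_false] at a1 a2
    exact add_mem a1 a2
  have hev : ∀ i, ∀ z ∈ wickSpan Φ s v S False, s * e i * s * z ∈ wickSpan Φ s v S False := by
    intro i z hz
    have := self_mul_mem_wickSpan (mul_mem_wickSpan (heS i) (self_mul_mem_wickSpan hz))
    simpa only [not_false_eq_true, not_true_eq_false, mul_assoc] using this
  have hy : ∀ i, x * e i * x = s * e i * s + m • (e i * s + s * e i) := by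
    intro i
    rw [hx, Algebra.algebraMap_eq_smul_one]
    simp only [add_mul, mul_add, smul_mul_assoc, mul_smul_comm, one_mul, mul_one, smul_add,
      smul_smul, hm, zero_smul, add_zero]
    abel
  have hstep : ∀ i z o, o ∈ wickSpan Φ s v S False → z ∈ wickSpan Φ s v S True →
      ∃ o' ∈ wickSpan Φ s v S False, x * e i * x * (z + m • o) = s * e i * s * z + m • o' := by
    intro i z o ho hz
    refine ⟨(e i * s + s * e i) * z + s * e i * s * o, add_mem (hodd i z hz) (hev i o ho), ?_⟩
    rw [hy]
    generalize s * e i * s = a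
    generalize e i * s + s * e i = d
    simp only [add_mul, mul_add, smul_mul_assoc, mul_smul_comm, smul_add, smul_smul, hm, zero_smul,
      add_zero]
    abel
  induction l using List.twoStepInduction with
  | nil => exact ⟨0, zero_mem _, by simp [poissonWord]⟩
  | singleton i =>
    have h1E : (1 : A) ∈ wickSpan Φ s v S True := by simpa [poissonWord] using heven []
    obtain ⟨o, ho, h⟩ := hstep i 1 0 (zero_mem _) h1E
    refine ⟨o, ho, ?_⟩
    simp only [smul_zero, add_zero, mul_one] at h
    rw [poissonWord, poissonWord, h]
    abel
  | cons_cons i j l ih ih' =>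
    obtain ⟨o₁, ho₁, h₁⟩ := ih
    obtain ⟨o₂, ho₂, h₂⟩ := ih' j
    obtain ⟨o₃, ho₃, h₃⟩ := hstep i _ o₂ ho₂ (heven (j :: l))
    rw [← h₂] at h₃
    -- The coefficient of m obeys the recursion of `poissonWord`; o₃ already includes the
    -- perturbation of the leading factor.
    refine ⟨o₃ - (v * Φ (e i)) • o₂ - if i = j then v • (o₂ + (v * Φ (e i)) • o₁) else 0, ?_, ?_⟩
    · refine sub_mem (sub_mem ho₃ (Submodule.smul_mem _ _ ho₂)) ?_
      split_ifs
      · exact Submodule.smul_mem _ _ (add_mem ho₂ (Submodule.smul_mem _ _ ho₁))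
      · exact zero_mem _
    · rw [poissonWord, poissonWord, sub_mul, sub_mul, h₃, h₂, h₁, ← Algebra.smul_def,
        ← Algebra.smul_def]
      split_ifs
      · simp only [smul_add, smul_sub, smul_smul]
        simp only [mul_comm m, ← mul_assoc]
        simp only [mul_assoc]
        abel
      · simp only [smul_add, smul_sub, smul_smul, mul_comm m, smul_zero]
        abel

end PoissonWords

/-! ### Freeness and moments from vanishing words. -/

section PoissonFree

variable {R : Type*} [CommRing R] {A : Type*} [Ring A] [Algebra R A] {κ : Type*} [DecidableEq κ]
  {r : κ → R} {v : R} {y : κ → A}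

/-- The correction term of the recursion appears only between equal neighbours, so a word factors at
the end of a run. -/
theorem poissonWord_replicate_append {i : κ} {l : List κ} (hl : ∀ j ∈ l.head?, i ≠ j) :
    ∀ n, poissonWord r v y (List.replicate n i ++ l) =
      poissonWord r v y (List.replicate n i) * poissonWord r v y l
  | 0 => by simp [poissonWord]
  | 1 => by
    cases l with
    | nil => simp [poissonWord]
    | cons j l => simp [poissonWord, hl j (by simp)]
  | n + 2 => by
    have h1 := poissonWord_replicate_append hl (n + 1)
    have h0 := poissonWord_replicate_append hl n
    simp only [List.replicate_succ, List.cons_append, poissonWord, if_true] at h1 ⊢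
    rw [h1, h0]
    simp only [sub_mul, add_mul, mul_assoc, smul_mul_assoc]

/-- The span of the nonempty words in the single index `i`. -/
def powerSpan (r : κ → R) (v : R) (y : κ → A) (i : κ) : Submodule R A :=
  Submodule.span R (Set.range fun n => poissonWord r v y (List.replicate (n + 1) i))

/-- The span of the words whose first index is `i`. -/
def headSpan (r : κ → R) (v : R) (y : κ → A) (i : κ) : Submodule R A :=
  Submodule.span R (Set.range fun l => poissonWord r v y (i :: l))

theorem powerSpan_le_headSpan (i : κ) : powerSpan r v y i ≤ headSpan r v y i := by
  refine Submodule.span_mono ?_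
  rintro _ ⟨n, rfl⟩
  exact ⟨List.replicate n i, rfl⟩

theorem mul_mem_headSpan {i j : κ} (hij : i ≠ j) {a z : A} (ha : a ∈ powerSpan r v y i)
    (hz : z ∈ headSpan r v y j) : a * z ∈ headSpan r v y i := by
  have h := Submodule.mul_mem_mul ha hz
  rw [powerSpan, headSpan, Submodule.span_mul_span] at h
  refine Submodule.span_mono ?_ h
  rintro _ ⟨_, ⟨n, rfl⟩, _, ⟨l, rfl⟩, rfl⟩
  refine ⟨List.replicate n i ++ j :: l, ?_⟩
  have := poissonWord_replicate_append (r := r) (v := v) (y := y) (i := i) (l := j :: l)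
    (by simpa using hij) (n + 1)
  simpa only [List.replicate_succ, List.cons_append] using this

/-- The recursion on constant words, solved for y i times a word, keeps the span stable. Hence this
span contains all polynomials in y i. -/
theorem self_mul_mem_span_one_sup (i : κ) {z : A}
    (hz : z ∈ Submodule.span R {(1 : A)} ⊔ powerSpan r v y i) :
    y i * z ∈ Submodule.span R {(1 : A)} ⊔ powerSpan r v y i := by
  have hw : ∀ n, poissonWord r v y (List.replicate n i) ∈
      Submodule.span R {(1 : A)} ⊔ powerSpan r v y i := by
    intro n
    cases n with
    | zero => exact Submodule.mem_sup_left (Submodule.mem_span_singleton_self _)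
    | succ n => exact Submodule.mem_sup_right (Submodule.subset_span ⟨n, rfl⟩)
  have hone : y i ∈ Submodule.span R {(1 : A)} ⊔ powerSpan r v y i := by
    have h := add_mem (hw 1) (Submodule.smul_mem _ (v * r i) (hw 0))
    simpa [poissonWord, Algebra.algebraMap_eq_smul_one] using h
  have hstep : ∀ n, y i * poissonWord r v y (List.replicate (n + 1) i) ∈
      Submodule.span R {(1 : A)} ⊔ powerSpan r v y i := by
    intro n
    have h2 := hw (n + 2)
    have h1 := hw (n + 1)
    have h0 := hw n
    simp only [List.replicate_succ, poissonWord, if_true] at h2 h1 ⊢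
    have := add_mem (add_mem h2 (Submodule.smul_mem _ v
      (add_mem h1 (Submodule.smul_mem _ (v * r i) h0)))) (Submodule.smul_mem _ (v * r i) h1)
    rwa [sub_add_cancel, sub_mul, ← Algebra.smul_def, sub_add_cancel] at this
  obtain ⟨a, ha, b, hb, rfl⟩ := Submodule.mem_sup.1 hz
  obtain ⟨t, rfl⟩ := Submodule.mem_span_singleton.1 ha
  rw [mul_add, mul_smul_comm, mul_one]
  refine add_mem (Submodule.smul_mem _ t hone) ?_
  clear ha hz
  induction hb using Submodule.span_induction with
  | mem b hb =>
    obtain ⟨n, rfl⟩ := hb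
    exact hstep n
  | zero => simp
  | add b c _ _ hb hc => rw [mul_add]; exact add_mem hb hc
  | smul t b _ hb => rw [mul_smul_comm]; exact Submodule.smul_mem _ _ hb

theorem adjoin_mul_mem_span_one_sup (i : κ) {a : A} (ha : a ∈ Algebra.adjoin R {y i}) :
    ∀ z ∈ Submodule.span R {(1 : A)} ⊔ powerSpan r v y i,
      a * z ∈ Submodule.span R {(1 : A)} ⊔ powerSpan r v y i := by
  induction ha using Algebra.adjoin_induction with
  | mem a ha =>
    rw [Set.mem_singleton_iff] at ha
    subst ha
    exact fun z hz => self_mul_mem_span_one_sup i hz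
  | algebraMap t =>
    intro z hz
    rw [← Algebra.smul_def]
    exact Submodule.smul_mem _ _ hz
  | add a b _ _ ha hb =>
    intro z hz
    rw [add_mul]
    exact add_mem (ha z hz) (hb z hz)
  | mul a b _ _ ha hb =>
    intro z hz
    rw [mul_assoc]
    exact ha _ (hb z hz)

variable {Φ : A →ₗ[R] R}

theorem map_headSpan (hw : ∀ l, l ≠ [] → Φ (poissonWord r v y l) = 0) {i : κ} {z : A}
    (hz : z ∈ headSpan r v y i) : Φ z = 0 := by
  have : headSpan r v y i ≤ LinearMap.ker Φ := by
    refine Submodule.span_le.2 ?_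
    rintro _ ⟨l, rfl⟩
    exact hw _ (List.cons_ne_nil _ _)
  exact this hz

theorem mem_powerSpan (h1 : Φ 1 = 1) (hw : ∀ l, l ≠ [] → Φ (poissonWord r v y l) = 0) {i : κ}
    {a : A} (ha : a ∈ Algebra.adjoin R {y i}) (h0 : Φ a = 0) : a ∈ powerSpan r v y i := by
  have h := adjoin_mul_mem_span_one_sup (r := r) (v := v) i ha 1
    (Submodule.mem_sup_left (Submodule.mem_span_singleton_self _))
  rw [mul_one] at h
  obtain ⟨c, hc, b, hb, rfl⟩ := Submodule.mem_sup.1 h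
  obtain ⟨t, rfl⟩ := Submodule.mem_span_singleton.1 hc
  rw [map_add, map_smul, h1, map_headSpan hw (powerSpan_le_headSpan i hb), smul_eq_mul, mul_one,
    add_zero] at h0
  rwa [h0, zero_smul, zero_add]

/-- A centred polynomial in y i has no constant term in the basis of words, so an alternating
product of such polynomials is a combination of nonempty words. -/
theorem isFreeFamily_of_poissonWord (h1 : Φ 1 = 1)
    (hw : ∀ l, l ≠ [] → Φ (poissonWord r v y l) = 0) :
    IsFreeFamily Φ (fun i => Algebra.adjoin R {y i}) := by
  have key : ∀ (l : List (κ × A)) (p : κ × A),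
      IsCentredWord Φ (fun i => Algebra.adjoin R {y i}) (p :: l) →
      ((p :: l).map Prod.snd).prod ∈ headSpan r v y p.1 := by
    intro l
    induction l with
    | nil =>
      intro p hp
      obtain ⟨h2, h3⟩ := hp.2 p List.mem_cons_self
      simpa using powerSpan_le_headSpan p.1 (mem_powerSpan h1 hw h2 h3)
    | cons q l ih =>
      intro p hp
      obtain ⟨h2, h3⟩ := hp.2 p List.mem_cons_self
      rw [List.map_cons, List.prod_cons]
      refine mul_mem_headSpan (List.isChain_cons_cons.1 hp.1).1 (mem_powerSpan h1 hw h2 h3)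
        (ih q ⟨(List.isChain_cons_cons.1 hp.1).2, fun q' hq' => ?_⟩)
      exact hp.2 q' (List.mem_cons_of_mem _ hq')
  intro l hl hc
  cases l with
  | nil => exact absurd rfl hl
  | cons p l => exact map_headSpan hw (key l p hc)

/-- The array with first row `p` and `binomialArray v p (n + 1) k` equal to
`binomialArray v p n (k + 1) + v • binomialArray v p n k`. -/
def binomialArray (v : R) (p : ℕ → A) : ℕ → ℕ → A
  | 0, k => p k
  | n + 1, k => binomialArray v p n (k + 1) + v • binomialArray v p n k

theorem binomialArray_add_three {p : ℕ → A} {z : A} {t : R}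
    (hp : ∀ n, p (n + 2) = z * p (n + 1) - (v * t) • p (n + 1) -
      v • (p (n + 1) + (v * t) • p n)) (n : ℕ) : ∀ k,
    binomialArray v p n (k + 3) = z * binomialArray v p n (k + 2) -
      (v * t) • binomialArray v p n (k + 2) -
      v • (binomialArray v p n (k + 2) + (v * t) • binomialArray v p n (k + 1)) := by
  induction n with
  | zero => exact fun k => hp (k + 1)
  | succ n ih =>
    intro k
    have h1 := ih (k + 1)
    simp only [add_assoc, Nat.reduceAdd] at h1
    simp only [binomialArray, add_assoc, Nat.reduceAdd, h1, ih k, mul_add, mul_smul_comm, smul_add,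
      smul_sub, smul_smul, mul_comm v]
    simp only [mul_comm t, mul_assoc]
    abel

/-- The Fock space sequence attached to the free Poisson cumulants `v ^ n * t`. -/
def poissonFockSeq (v : R) (p : ℕ → A) : ℕ → A
  | 0 => 1
  | n + 1 => binomialArray v p n 1

/-- For the geometric cumulants v ^ n * t, subtracting v times the Fock recursion at the previous
index telescopes its sum. This is the resulting three-term form. -/
theorem poissonFockSeq_add_two {p : ℕ → A} {z : A} {t : R} (hp0 : p 0 = 1)
    (hp1 : p 1 = z - (v * t) • (1 : A))
    (hp : ∀ n, p (n + 2) = z * p (n + 1) - (v * t) • p (n + 1) -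
      v • (p (n + 1) + (v * t) • p n)) (n : ℕ) :
    poissonFockSeq v p (n + 2) = z * poissonFockSeq v p (n + 1) -
      (v * t) • poissonFockSeq v p (n + 1) +
      v • (poissonFockSeq v p (n + 1) - z * poissonFockSeq v p n) := by
  cases n with
  | zero =>
    have h2 := hp 0
    simp only [zero_add] at h2
    simp only [poissonFockSeq, binomialArray, Nat.reduceAdd, h2, hp1, hp0, mul_sub,
      smul_sub, smul_add, mul_smul_comm, mul_one]
    abel
  | succ n =>
    have h3 := binomialArray_add_three hp n 0
    simp only [zero_add] at h3
    simp only [poissonFockSeq, binomialArray, Nat.reduceAdd, h3, mul_add,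
      smul_sub, smul_add, mul_smul_comm, smul_smul, mul_comm v]
    simp only [mul_comm t, mul_assoc]
    abel

theorem isFockSeq_poissonFockSeq {p : ℕ → A} {z : A} {t : R} (hp0 : p 0 = 1)
    (hp1 : p 1 = z - (v * t) • (1 : A))
    (hp : ∀ n, p (n + 2) = z * p (n + 1) - (v * t) • p (n + 1) -
      v • (p (n + 1) + (v * t) • p n)) :
    IsFockSeq (fun n => v ^ n * t) z (poissonFockSeq v p) := by
  refine ⟨rfl, fun n => ?_⟩
  induction n with
  | zero => simp [poissonFockSeq, binomialArray, hp1]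
  | succ n ih =>
    rw [poissonFockSeq_add_two hp0 hp1 hp, ih, Finset.sum_range_succ' _ (n + 1)]
    have : ∀ k, v ^ (k + 1 + 1) * t = v * (v ^ (k + 1) * t) := fun k => by ring
    simp only [Nat.add_sub_add_right, this, ← smul_smul v, ← Finset.smul_sum]
    rw [← ih]
    simp only [zero_add, pow_one, Nat.sub_zero, smul_smul, smul_sub]
    have ih2 : v • poissonFockSeq v p (n + 1) - v • (z * poissonFockSeq v p n) =
      - (v • ∑ k ∈ Finset.range (n + 1), (v ^ (k + 1) * t) • poissonFockSeq v p (n - k)) := by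
      rw [ih, smul_sub]; abel
    rw [ih2]
    abel

/-- Each positive term of the Fock sequence is a binomial combination of nonempty constant words,
with no contribution from p 0, so Φ kills it and `IsFockSeq.map_pow` applies. -/
theorem map_pow_of_poissonWord (h1 : Φ 1 = 1)
    (hw : ∀ l, l ≠ [] → Φ (poissonWord r v y l) = 0) (i : κ) (a : ℕ) :
    Φ (y i ^ a) = stackMoment (fun n => v ^ n * r i) a 0 := by
  set p : ℕ → A := fun n => poissonWord r v y (List.replicate n i) with hpdef
  have hp : ∀ n, p (n + 2) = y i * p (n + 1) - (v * r i) • p (n + 1) -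
      v • (p (n + 1) + (v * r i) • p n) := by
    intro n
    simp only [hpdef, List.replicate_succ, poissonWord, if_true, sub_mul, ← Algebra.smul_def]
  have hp1 : p 1 = y i - (v * r i) • (1 : A) := by
    simp [hpdef, poissonWord, Algebra.algebraMap_eq_smul_one]
  refine (isFockSeq_poissonFockSeq rfl hp1 hp).map_pow Φ h1 ?_ a
  have hD : ∀ n k, Φ (binomialArray v p n (k + 1)) = 0 := by
    intro n
    induction n with
    | zero => exact fun k => hw _ (by simp)
    | succ n ih =>
      intro k
      rw [binomialArray, map_add, map_smul, ih, ih, smul_zero, add_zero]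
  intro n hn
  obtain ⟨n, rfl⟩ := Nat.exists_eq_add_of_le' hn
  exact hD n 0

end PoissonFree

/-! ### Compressions of a semicircular element by free projections. -/

section Compression

variable {R : Type*} [CommRing R] {A : Type*} [Ring A] [Algebra R A]

/-- The cumulants of a semicircular element of mean `m` and variance `v`. -/
def semicircularCumulants (m v : R) (n : ℕ) : R :=
  if n = 1 then m else if n = 2 then v else 0

/-- With only the cumulants of order 1 and 2 present, the Fock recursion is the Chebyshev recursion
in x - m. -/
theorem isFockSeq_cheb (x : A) (m v : R) :
    IsFockSeq (semicircularCumulants m v) x (cheb (x - algebraMap R A m) v) := by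
  refine ⟨rfl, fun n => ?_⟩
  cases n with
  | zero => simp [cheb, semicircularCumulants, Algebra.algebraMap_eq_smul_one]
  | succ n =>
    rw [cheb, Finset.sum_range_succ', Finset.sum_range_succ', Finset.sum_eq_zero]
    · simp [semicircularCumulants, sub_mul, Algebra.algebraMap_eq_smul_one]
      abel
    · intro k _
      simp [semicircularCumulants]

variable {Φ : A →ₗ[R] R} {κ : Type*} [DecidableEq κ]

theorem map_poissonWord_compression (h1 : Φ 1 = 1) {B : Fin 2 → Subalgebra R A}
    (hfree : IsFreeFamily Φ B) {x : A} (hxB : x ∈ B 1) {m v : R} (hm : m * m = 0)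
    (hx : ∀ a, Φ (x ^ a) = stackMoment (semicircularCumulants m v) a 0)
    {e : κ → A} (heB : ∀ i, e i ∈ B 0) (he : ∀ i, e i * e i = e i)
    (horth : ∀ i j, i ≠ j → e i * e j = 0) (l : List κ) (hl : l ≠ []) :
    Φ (poissonWord (fun i => Φ (e i)) v (fun i => x * e i * x) l) = 0 := by
  have hU := (isFockSeq_cheb x m v).map_eq_zero Φ hx
  have hs : x - algebraMap R A m ∈ B 1 := (B 1).sub_mem hxB ((B 1).algebraMap_mem m)
  obtain ⟨o, ho, h⟩ := poissonWord_perturb (v := v) h1 he horth heB hm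
    (x := x) (s := x - algebraMap R A m) (by rw [sub_add_cancel]) l
  rw [h, map_add, map_smul, map_wickSpan_false h1 hfree (by decide) hs hU ho, smul_zero, add_zero,
    poissonWord_eq_wick h1 he horth]
  refine hfree.map_centredSpan ((wick_mem_centredSpan h1 (i := 0) (j := 1) (by decide) hs hU _ ?_).2
    ?_)
  · intro b hb
    obtain ⟨i, -, hi⟩ := List.mem_flatMap.1 hb
    simp only [List.mem_cons, List.not_mem_nil, or_false] at hi
    rcases hi with rfl | rfl
    · exact heB i
    · exact (B 0).one_mem
  · cases l with
    | nil => exact absurd rfl hl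
    | cons i l => simp

end Compression

/-! ### The palindromic formula as a Leibniz rule. -/

section Palindromes

theorem isChain_replace {ι A : Type*} {l₁ l₂ : List (ι × A)} {i : ι} {a : A} (b : A)
    (h : (l₁ ++ (i, a) :: l₂).IsChain (fun p q => p.1 ≠ q.1)) :
    (l₁ ++ (i, b) :: l₂).IsChain (fun p q => p.1 ≠ q.1) := by
  have hc := (List.isChain_map (R := (· ≠ ·)) (Prod.fst (α := ι) (β := A))).2 h
  refine (List.isChain_map (R := (· ≠ ·)) (Prod.fst (α := ι) (β := A))).1 ?_
  simpa using hc

variable {A : Type*} [Ring A] [Algebra ℂ A] {ι : Type*}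
  {φ φ' : A →ₗ[ℂ] ℂ} {B : ι → Subalgebra ℂ A}

theorem IsCentredWord.replace {l₁ l₂ : List (ι × A)} {i : ι} {a b : A}
    (h : IsCentredWord φ B (l₁ ++ (i, a) :: l₂)) (hb : b ∈ B i) (h0 : φ b = 0) :
    IsCentredWord φ B (l₁ ++ (i, b) :: l₂) := by
  refine ⟨isChain_replace b h.1, fun p hp => ?_⟩
  rw [List.mem_append, List.mem_cons] at hp
  rcases hp with hp | rfl | hp
  · exact h.2 p (by simp [hp])
  · exact ⟨hb, h0⟩
  · exact h.2 p (by simp [hp])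

theorem IsCentredWord.of_append_left {l₁ l₂ : List (ι × A)}
    (h : IsCentredWord φ B (l₁ ++ l₂)) : IsCentredWord φ B l₁ :=
  ⟨(List.isChain_append.1 h.1).1, fun p hp => h.2 p (List.mem_append_left _ hp)⟩

theorem IsCentredWord.of_append_right {l₁ l₂ : List (ι × A)}
    (h : IsCentredWord φ B (l₁ ++ l₂)) : IsCentredWord φ B l₂ :=
  ⟨(List.isChain_append.1 h.1).2.1, fun p hp => h.2 p (List.mem_append_right _ hp)⟩

theorem IsCentredWord.reverse {l : List (ι × A)} (h : IsCentredWord φ B l) :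
    IsCentredWord φ B l.reverse :=
  ⟨List.isChain_reverse.2 (h.1.imp fun _ _ hne => hne.symm),
    fun p hp => h.2 p (List.mem_reverse.1 hp)⟩

theorem IsCentredWord.tail {p : ι × A} {l : List (ι × A)} (h : IsCentredWord φ B (p :: l)) :
    IsCentredWord φ B l := IsCentredWord.of_append_right (l₁ := [p]) h

/-- The value of `φ` on `⋯ a₂ a₁ b₁ b₂ ⋯` for two alternating centred words. -/
noncomputable def pairing [DecidableEq ι] (φ : A →ₗ[ℂ] ℂ) : List (ι × A) → List (ι × A) → ℂ
  | [], [] => 1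
  | p :: l, q :: r => if p.1 = q.1 then φ (p.2 * q.2) * pairing φ l r else 0
  | [], _ :: _ => 0
  | _ :: _, [] => 0

/-- If the two innermost letters share an index, centring their product gives an alternating centred
word, so only its expectation times the shorter pairing survives. If not, the concatenation is
itself alternating and centred. -/
theorem IsFreeFamily.map_reverse_mul [DecidableEq ι] (hfree : IsFreeFamily φ B) (h1 : φ 1 = 1) :
    ∀ l r : List (ι × A), IsCentredWord φ B l → IsCentredWord φ B r →
      φ ((l.reverse.map Prod.snd).prod * (r.map Prod.snd).prod) = pairing φ l r
  | [], [], _, _ => by simp [pairing, h1]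
  | [], q :: r, _, hr => by
    simpa [pairing] using hfree (q :: r) (List.cons_ne_nil _ _) hr
  | p :: l, [], hl, _ => by
    have := hfree _ (by simp) hl.reverse
    rw [pairing, List.map_nil, List.prod_nil, mul_one, this]
  | p :: l, q :: r, hl, hr => by
    obtain ⟨i, a⟩ := p
    obtain ⟨j, b⟩ := q
    rw [pairing]
    split_ifs with hij
    · dsimp only at hij
      subst hij
      have ha := hl.2 _ List.mem_cons_self
      have hb := hr.2 _ List.mem_cons_self
      have hw : IsCentredWord φ B
          (l.reverse ++ (i, a * b - algebraMap ℂ A (φ (a * b))) :: r) := by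
        have hl' := hl.reverse
        rw [List.reverse_cons] at hl'
        refine ⟨List.isChain_append.2 ⟨hl'.of_append_left.1,
          isChain_replace (l₁ := []) _ hr.1, ?_⟩, ?_⟩
        · intro x hx y hy
          have := (List.isChain_append.1 hl'.1).2.2 x hx (i, a) (by simp)
          simp only [List.head?_cons, Option.mem_def, Option.some.injEq] at hy
          rw [← hy]
          exact this
        · intro x hx
          rw [List.mem_append, List.mem_cons] at hx
          rcases hx with hx | rfl | hx
          · exact hl.2 x (List.mem_cons_of_mem _ (List.mem_reverse.1 hx))
          · refine ⟨(B i).sub_mem ((B i).mul_mem ha.1 hb.1) ((B i).algebraMap_mem _), ?_⟩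
            simp [Algebra.algebraMap_eq_smul_one, h1]
          · exact hr.2 x (List.mem_cons_of_mem _ hx)
      have h0 := hfree _ (by simp) hw
      have ih := IsFreeFamily.map_reverse_mul hfree h1 l r hl.tail hr.tail
      simp only [List.map_append, List.map_cons, List.prod_append, List.prod_cons, sub_mul, mul_sub,
        map_sub, ← Algebra.smul_def, mul_smul_comm, map_smul, ih, smul_eq_mul, sub_eq_zero] at h0
      rw [← h0]
      simp [mul_assoc]
    · have hw : IsCentredWord φ B (((i, a) :: l).reverse ++ (j, b) :: r) := by
        refine ⟨List.isChain_append.2 ⟨hl.reverse.1, hr.1, ?_⟩, ?_⟩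
        · intro x hx y hy
          simp only [List.head?_cons, Option.mem_def, Option.some.injEq, List.getLast?_reverse]
            at hx hy
          rw [← hx, ← hy]
          exact hij
        · intro x hx
          rcases List.mem_append.1 hx with hx | hx
          · exact hl.2 x (List.mem_reverse.1 hx)
          · exact hr.2 x hx
      simpa [mul_assoc] using hfree _ (by simp) hw

theorem pairing_eq_zero [DecidableEq ι] : ∀ l r : List (ι × A), l.length ≠ r.length →
    pairing φ l r = 0
  | [], [], h => absurd rfl h
  | [], _ :: _, _ => rfl
  | _ :: _, [], _ => rfl
  | p :: l, q :: r, h => by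
    rw [pairing, pairing_eq_zero l r (by simpa using h), mul_zero, ite_self]

theorem pairing_ofFn [DecidableEq ι] : ∀ (m : ℕ) (f g : Fin m → ι × A),
    pairing φ (List.ofFn f) (List.ofFn g) =
      if ∀ k, (f k).1 = (g k).1 then ∏ k, φ ((f k).2 * (g k).2) else 0
  | 0, f, g => by simp [pairing]
  | m + 1, f, g => by
    rw [List.ofFn_succ, List.ofFn_succ, pairing, pairing_ofFn m, Fin.prod_univ_succ]
    simp only [Fin.forall_fin_succ]
    split_ifs <;> simp_all

/-- `∑ⱼ φ' (aⱼ) φ (c a₁ ⋯ aⱼ₋₁ aⱼ₊₁ ⋯ aₙ)`. -/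
noncomputable def omitSum (φ φ' : A →ₗ[ℂ] ℂ) : A → List (ι × A) → ℂ
  | _, [] => 0
  | c, p :: l => φ' p.2 * φ (c * (l.map Prod.snd).prod) + omitSum φ φ' (c * p.2) l

theorem omitSum_eq_sum (l : List (ι × A)) : ∀ c, omitSum φ φ' c l =
    ∑ j : Fin l.length, φ' (l.get j).2 *
      φ (c * (((l.take j).map Prod.snd).prod * ((l.drop (j + 1)).map Prod.snd).prod)) := by
  induction l with
  | nil => intro c; simp [omitSum]
  | cons p l ih =>
    intro c
    rw [omitSum, ih]
    refine Eq.symm ((Fin.sum_univ_succ (n := l.length) _).trans ?_)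
    simp [mul_assoc]

theorem omitSum_term [DecidableEq ι] (hfree : IsFreeFamily φ B) (h1 : φ 1 = 1) {l : List (ι × A)}
    (hl : IsCentredWord φ B l) (j : ℕ) :
    φ (((l.take j).map Prod.snd).prod * ((l.drop (j + 1)).map Prod.snd).prod) =
      pairing φ (l.take j).reverse (l.drop (j + 1)) := by
  have h := hl
  rw [← List.take_append_drop j l] at h
  have h' := hl
  rw [← List.take_append_drop (j + 1) l] at h'
  rw [← hfree.map_reverse_mul h1 _ _ h.of_append_left.reverse h'.of_append_right,
    List.reverse_reverse]

theorem forall_eq_rev_iff {m n : ℕ} (h : n = 2 * m + 1) (i : Fin n → ι) :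
    (∀ j, i j = i j.rev) ↔
      ∀ k : Fin m, i ⟨m - 1 - k, by omega⟩ = i ⟨m + 1 + k, by omega⟩ := by
  constructor
  · intro hi k
    rw [hi]
    congr 1
    ext
    simp only [Fin.val_rev]
    omega
  · intro hi j
    rcases lt_trichotomy j.val m with hj | hj | hj
    · have := hi ⟨m - 1 - j, by omega⟩
      convert this using 2 <;> ext <;> simp only [Fin.val_rev] <;> omega
    · congr 1
      ext
      simp only [Fin.val_rev]
      omega
    · have := (hi ⟨j - m - 1, by omega⟩).symm
      convert this using 2 <;> ext <;> simp only [Fin.val_rev] <;> omega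

theorem prod_filter_rev {m n : ℕ} (h : n = 2 * m + 1) (f : Fin n → Fin n → ℂ) :
    ∏ k : Fin m, f ⟨m - 1 - k, by omega⟩ ⟨m + 1 + k, by omega⟩ =
      ∏ j : Fin n with j.val < m, f j j.rev := by
  refine Finset.prod_bij (fun k _ => ⟨m - 1 - k, by omega⟩) ?_ ?_ ?_ ?_
  · intro k _
    simp only [Finset.mem_filter, Finset.mem_univ, true_and]
    omega
  · intro k _ k' _ hk
    rw [Fin.mk.injEq] at hk
    ext
    omega
  · intro j hj
    simp only [Finset.mem_filter, Finset.mem_univ, true_and] at hj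
    refine ⟨⟨m - 1 - j, by omega⟩, Finset.mem_univ _, ?_⟩
    ext
    simp only
    omega
  · intro k _
    congr 1
    ext
    simp only [Fin.val_rev]
    omega

/-- The palindromic formula for `φ'` in the definition of infinitesimal freeness, as a Leibniz
rule. -/
theorem omitSum_ofFn (hfree : IsFreeFamily φ B) (h1 : φ 1 = 1) {n : ℕ} (i : Fin n → ι)
    (a : Fin n → A) (hw : IsCentredWord φ B (List.ofFn fun j => (i j, a j))) :
    (∀ (m : ℕ) (h : n = 2 * m + 1), (∀ j, i j = i j.rev) →
      omitSum φ φ' 1 (List.ofFn fun j => (i j, a j)) =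
        (∏ j : Fin n with j.val < m, φ (a j * a j.rev)) * φ' (a ⟨m, by omega⟩)) ∧
    (¬ (Odd n ∧ ∀ j, i j = i j.rev) → omitSum φ φ' 1 (List.ofFn fun j => (i j, a j)) = 0) := by
  classical
  have hlen : (List.ofFn fun j => (i j, a j)).length = n := List.length_ofFn
  have hzero : ∀ j, n ≠ 2 * j + 1 → j < n →
      pairing φ ((List.ofFn fun j => (i j, a j)).take j).reverse
        ((List.ofFn fun j => (i j, a j)).drop (j + 1)) = 0 := by
    intro j hj hjn
    refine pairing_eq_zero _ _ ?_
    simp only [List.length_reverse, List.length_take, List.length_drop, hlen]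
    omega
  have hodd : ∀ (m : ℕ) (h : n = 2 * m + 1), omitSum φ φ' 1 (List.ofFn fun j => (i j, a j)) =
      φ' (a ⟨m, by omega⟩) * if ∀ j, i j = i j.rev then
        ∏ j : Fin n with j.val < m, φ (a j * a j.rev) else 0 := by
    intro m h
    rw [omitSum_eq_sum]
    simp only [one_mul, omitSum_term hfree h1 hw]
    -- Omitting letter j leaves pieces of lengths j and n - 1 - j, whose pairing vanishes unless the
    -- lengths agree; only the middle letter remains.
    rw [Finset.sum_eq_single ⟨m, by omega⟩]
    · have e1 : ((List.ofFn fun j => (i j, a j)).take m).reverse =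
          List.ofFn fun k : Fin m => (i ⟨m - 1 - k, by omega⟩, a ⟨m - 1 - k, by omega⟩) := by
        refine List.ext_getElem (by simp; omega) fun k hk hk' => ?_
        simp only [List.length_ofFn] at hk'
        have : min m n = m := by omega
        simp [this]
      have e2 : (List.ofFn fun j => (i j, a j)).drop (m + 1) =
          List.ofFn fun k : Fin m => (i ⟨m + 1 + k, by omega⟩, a ⟨m + 1 + k, by omega⟩) := by
        refine List.ext_getElem (by simp; omega) fun k hk hk' => ?_
        simp
      simp only [e1, e2, pairing_ofFn, forall_eq_rev_iff h]
      rw [← prod_filter_rev h fun j j' => φ (a j * a j')]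
      simp
    · intro j _ hj
      rw [hzero j ?_ (by omega), mul_zero]
      intro h'
      exact hj (Fin.ext (by simp only; omega))
    · simp
  constructor
  · intro m h hi
    rw [hodd m h, if_pos hi, mul_comm]
  · intro hn
    by_cases ho : Odd n
    · obtain ⟨m, h⟩ := ho
      rw [hodd m h, if_neg fun hi => hn ⟨⟨m, h⟩, hi⟩, mul_zero]
    · rw [omitSum_eq_sum]
      refine Finset.sum_eq_zero fun j _ => ?_
      rw [one_mul, omitSum_term hfree h1 hw, hzero j (fun h => ho ⟨j, h⟩) (by omega), mul_zero]

theorem isCentredWord_ofFn {n : ℕ} {i : Fin n → ι} {a : Fin n → A} :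
    IsCentredWord φ B (List.ofFn fun j => (i j, a j)) ↔
      (∀ (j : ℕ) (h : j + 1 < n), i ⟨j, Nat.lt_of_succ_lt h⟩ ≠ i ⟨j + 1, h⟩) ∧
      (∀ j, a j ∈ B (i j)) ∧ ∀ j, φ (a j) = 0 := by
  rw [IsCentredWord, List.isChain_ofFn]
  refine and_congr Iff.rfl ?_
  simp [List.mem_ofFn, forall_and]

/-- The Leibniz form treats all words alike, with no case split on palindromes, and is what the
coefficient of ε gives over the dual numbers. -/
theorem infinitesimallyFree_iff (h1 : φ 1 = 1) :
    InfinitesimallyFree φ φ' B ↔ IsFreeFamily φ B ∧ ∀ l : List (ι × A), l ≠ [] →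
      IsCentredWord φ B l → φ' (l.map Prod.snd).prod = omitSum φ φ' 1 l := by
  constructor
  · intro h
    have key : ∀ l : List (ι × A), l = List.ofFn fun j => ((l.get j).1, (l.get j).2) :=
      fun l => (List.ofFn_get l).symm
    have hsnd : ∀ l : List (ι × A), l.map Prod.snd = List.ofFn fun j => (l.get j).2 := by
      intro l
      conv_lhs => rw [key l]
      rw [List.map_ofFn]
      rfl
    have hfree : IsFreeFamily φ B := by
      intro l hl hw
      rw [key l, isCentredWord_ofFn] at hw
      rw [hsnd]
      exact (h l.length _ _ (List.length_pos_iff.2 hl) hw.1 hw.2.1 hw.2.2).1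
    refine ⟨hfree, fun l hl hw => ?_⟩
    rw [key l] at hw
    obtain ⟨o1, o2⟩ := omitSum_ofFn (φ' := φ') hfree h1 _ _ hw
    rw [isCentredWord_ofFn] at hw
    obtain ⟨-, f1, f2⟩ := h l.length _ _ (List.length_pos_iff.2 hl) hw.1 hw.2.1 hw.2.2
    rw [← key l] at o1 o2
    rw [hsnd]
    by_cases hp : Odd l.length ∧ ∀ j, (l.get j).1 = (l.get j.rev).1
    · obtain ⟨⟨m, hm⟩, hp⟩ := hp
      rw [f1 m hm hp, o1 m hm hp]
    · rw [f2 hp, o2 hp]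
  · rintro ⟨hfree, hl⟩ n i a hn hi ha h0
    have hw := isCentredWord_ofFn.2 ⟨hi, ha, h0⟩
    have hne : (List.ofFn fun j => (i j, a j)) ≠ [] := by
      rw [← List.length_pos_iff, List.length_ofFn]
      exact hn
    have hsnd : (List.ofFn fun j => (i j, a j)).map Prod.snd = List.ofFn a := by
      rw [List.map_ofFn]
      rfl
    obtain ⟨o1, o2⟩ := omitSum_ofFn (φ' := φ') hfree h1 _ _ hw
    have h2 := hl _ hne hw
    have h3 := hfree _ hne hw
    rw [hsnd] at h2 h3
    rw [h2]
    exact ⟨h3, o1, o2⟩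

end Palindromes

/-! ### Dual numbers: infinitesimal freeness as freeness of φ + εφ'. -/

section DualNumbers

open scoped TensorProduct

/-- The ring `ℂ[ε]` of dual numbers. Unlike for `DualNumber ℂ`, all its algebraic structure is
derived from the structure of commutative ring. -/
@[ext]
structure DualScalar where
  fst : ℂ
  snd : ℂ

namespace DualScalar

instance : Zero DualScalar := ⟨⟨0, 0⟩⟩
instance : One DualScalar := ⟨⟨1, 0⟩⟩
noncomputable instance : Add DualScalar := ⟨fun s t => ⟨s.fst + t.fst, s.snd + t.snd⟩⟩
noncomputable instance : Neg DualScalar := ⟨fun s => ⟨-s.fst, -s.snd⟩⟩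
noncomputable instance : Mul DualScalar :=
  ⟨fun s t => ⟨s.fst * t.fst, s.fst * t.snd + s.snd * t.fst⟩⟩

@[simp] theorem fst_zero : (0 : DualScalar).fst = 0 := rfl
@[simp] theorem snd_zero : (0 : DualScalar).snd = 0 := rfl
@[simp] theorem fst_one : (1 : DualScalar).fst = 1 := rfl
@[simp] theorem snd_one : (1 : DualScalar).snd = 0 := rfl
@[simp] theorem fst_add (s t : DualScalar) : (s + t).fst = s.fst + t.fst := rfl
@[simp] theorem snd_add (s t : DualScalar) : (s + t).snd = s.snd + t.snd := rfl
@[simp] theorem fst_neg (s : DualScalar) : (-s).fst = -s.fst := rfl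
@[simp] theorem snd_neg (s : DualScalar) : (-s).snd = -s.snd := rfl
@[simp] theorem fst_mul (s t : DualScalar) : (s * t).fst = s.fst * t.fst := rfl
@[simp] theorem snd_mul (s t : DualScalar) :
    (s * t).snd = s.fst * t.snd + s.snd * t.fst := rfl

noncomputable instance : CommRing DualScalar where
  add_assoc _ _ _ := by ext <;> simp [add_assoc]
  zero_add _ := by ext <;> simp
  add_zero _ := by ext <;> simp
  add_comm _ _ := by ext <;> simp [add_comm]
  nsmul := nsmulRec
  zsmul := zsmulRec
  neg_add_cancel _ := by ext <;> simp
  mul_assoc _ _ _ := by ext <;> simp <;> ring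
  one_mul _ := by ext <;> simp
  mul_one _ := by ext <;> simp
  zero_mul _ := by ext <;> simp
  mul_zero _ := by ext <;> simp
  mul_comm _ _ := by ext <;> simp <;> ring
  left_distrib _ _ _ := by ext <;> simp <;> ring
  right_distrib _ _ _ := by ext <;> simp <;> ring

noncomputable instance : Algebra ℂ DualScalar :=
  RingHom.toAlgebra
    { toFun := fun t => ⟨t, 0⟩
      map_one' := rfl
      map_zero' := rfl
      map_mul' := fun _ _ => by ext <;> simp
      map_add' := fun _ _ => by ext <;> simp }

theorem algebraMap_def (t : ℂ) : algebraMap ℂ DualScalar t = ⟨t, 0⟩ := rfl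

@[simp] theorem fst_smul (t : ℂ) (s : DualScalar) : (t • s).fst = t * s.fst := by
  rw [Algebra.smul_def, algebraMap_def, fst_mul]

@[simp] theorem snd_smul (t : ℂ) (s : DualScalar) : (t • s).snd = t * s.snd := by
  rw [Algebra.smul_def, algebraMap_def, snd_mul]
  simp

theorem fst_sum {κ : Type*} (s : Finset κ) (f : κ → DualScalar) :
    (∑ V ∈ s, f V).fst = ∑ V ∈ s, (f V).fst := by
  classical
  induction s using Finset.induction_on with
  | empty => simp
  | insert a s ha ih => rw [Finset.sum_insert ha, Finset.sum_insert ha, fst_add, ih]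

theorem snd_sum {κ : Type*} (s : Finset κ) (f : κ → DualScalar) :
    (∑ V ∈ s, f V).snd = ∑ V ∈ s, (f V).snd := by
  classical
  induction s using Finset.induction_on with
  | empty => simp
  | insert a s ha ih => rw [Finset.sum_insert ha, Finset.sum_insert ha, snd_add, ih]

theorem fst_prod {κ : Type*} (s : Finset κ) (f : κ → DualScalar) :
    (∏ V ∈ s, f V).fst = ∏ V ∈ s, (f V).fst := by
  classical
  induction s using Finset.induction_on with
  | empty => simp
  | insert a s ha ih => rw [Finset.prod_insert ha, Finset.prod_insert ha, fst_mul, ih]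

theorem snd_prod {κ : Type*} [DecidableEq κ] (s : Finset κ) (f : κ → DualScalar) :
    (∏ V ∈ s, f V).snd = ∑ V ∈ s, (f V).snd * ∏ W ∈ s.erase V, (f W).fst := by
  induction s using Finset.induction_on with
  | empty => simp
  | insert a s ha ih =>
    rw [Finset.prod_insert ha, Finset.sum_insert ha, snd_mul, ih, fst_prod,
      Finset.erase_insert ha, add_comm, Finset.mul_sum]
    congr 1
    refine Finset.sum_congr rfl fun V hV => ?_
    have hVa : a ≠ V := fun h => ha (h ▸ hV)
    rw [Finset.erase_insert_of_ne hVa, Finset.prod_insert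
      (fun h => ha (Finset.mem_of_mem_erase h))]
    ring

end DualScalar

variable {A : Type*} [Ring A] [Algebra ℂ A]

/-- The element `a + ε b` of the algebra of dual numbers over `A`. -/
noncomputable def dual (a b : A) : DualScalar ⊗[ℂ] A :=
  1 ⊗ₜ a + (⟨0, 1⟩ : DualScalar) ⊗ₜ b

/-- The extension of `φ + ε φ'` to a functional over the dual numbers. -/
noncomputable def dualFunctional (φ φ' : A →ₗ[ℂ] ℂ) :
    DualScalar ⊗[ℂ] A →ₗ[DualScalar] DualScalar :=
  LinearMap.liftBaseChange DualScalar
    { toFun := fun a => ⟨φ a, φ' a⟩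
      map_add' := fun _ _ => by ext <;> simp
      map_smul' := fun _ _ => by ext <;> simp }

variable {φ φ' : A →ₗ[ℂ] ℂ}

theorem dual_mul (a b a' b' : A) : dual a b * dual a' b' = dual (a * a') (a * b' + b * a') := by
  have heps : (⟨0, 1⟩ : DualScalar) * ⟨0, 1⟩ = 0 := by ext <;> simp
  simp only [dual, mul_add, add_mul, Algebra.TensorProduct.tmul_mul_tmul, one_mul, mul_one,
    heps, TensorProduct.zero_tmul, add_zero, TensorProduct.tmul_add]
  abel

theorem dual_one : dual (1 : A) 0 = 1 := by
  simp [dual, Algebra.TensorProduct.one_def]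

theorem dual_add (a b a' b' : A) : dual a b + dual a' b' = dual (a + a') (b + b') := by
  simp only [dual, TensorProduct.tmul_add]
  abel

theorem algebraMap_eq_dual (t : DualScalar) :
    algebraMap (DualScalar) (DualScalar ⊗[ℂ] A) t =
      dual (algebraMap ℂ A t.fst) (algebraMap ℂ A t.snd) := by
  rw [Algebra.TensorProduct.algebraMap_apply, dual, Algebra.algebraMap_eq_smul_one (A := A),
    Algebra.algebraMap_eq_smul_one (A := A), ← TensorProduct.smul_tmul,
    ← TensorProduct.smul_tmul, ← TensorProduct.add_tmul]
  congr 1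
  ext <;> simp

theorem dualFunctional_dual (a b : A) :
    dualFunctional φ φ' (dual a b) = ⟨φ a, φ' a + φ b⟩ := by
  rw [dual, map_add, dualFunctional, LinearMap.liftBaseChange_tmul, LinearMap.liftBaseChange_tmul]
  ext <;> simp

theorem dualFunctional_dual_eq_zero {a b : A} :
    dualFunctional φ φ' (dual a b) = 0 ↔ φ a = 0 ∧ φ' a + φ b = 0 := by
  rw [dualFunctional_dual, DualScalar.ext_iff]
  rfl

/-- The derivative `∑ⱼ a₁ ⋯ bⱼ ⋯ aₙ` of a product. -/
def derivProd {ι : Type*} : List (ι × A × A) → A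
  | [] => 0
  | p :: l => p.2.1 * derivProd l + p.2.2 * (l.map fun p => p.2.1).prod

variable {ι : Type*}

theorem prod_map_dual (l : List (ι × A × A)) :
    (l.map fun p => dual p.2.1 p.2.2).prod = dual (l.map fun p => p.2.1).prod (derivProd l) := by
  induction l with
  | nil => simp [derivProd, dual_one]
  | cons p l ih => simp [ih, dual_mul, derivProd]

variable {B : ι → Subalgebra ℂ A}
  {C : ι → Subalgebra (DualScalar) (DualScalar ⊗[ℂ] A)}

/-- Since b + φ' a is centred in the same subalgebra, putting it in place of a gives a word of
expectation zero. Each b thus acts as the scalar -φ' a; `pre` collects the letters already passed.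
-/
theorem map_mul_derivProd (h1 : φ 1 = 1) (hfree : IsFreeFamily φ B) (w : List (ι × A × A)) :
    ∀ pre : List (ι × A), IsCentredWord φ B (pre ++ w.map fun p => (p.1, p.2.1)) →
      (∀ p ∈ w, p.2.2 ∈ B p.1 ∧ φ' p.2.1 + φ p.2.2 = 0) →
      φ ((pre.map Prod.snd).prod * derivProd w) =
        - omitSum φ φ' (pre.map Prod.snd).prod (w.map fun p => (p.1, p.2.1)) := by
  induction w with
  | nil => intro pre _ _; simp [derivProd, omitSum]
  | cons p w ih =>
    intro pre hc hw
    obtain ⟨i, a, b⟩ := p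
    obtain ⟨hb, hb0⟩ := hw _ List.mem_cons_self
    dsimp only at hb hb0
    have hc' := hc
    rw [List.map_cons, List.append_cons] at hc'
    have ih := ih (pre ++ [(i, a)]) hc' fun p hp => hw p (List.mem_cons_of_mem _ hp)
    have h0 := hfree _ (by simp) (hc.replace (b := b + algebraMap ℂ A (φ' a))
      ((B i).add_mem hb ((B i).algebraMap_mem _)) (by
        rw [map_add, Algebra.algebraMap_eq_smul_one, map_smul, h1, smul_eq_mul, mul_one, add_comm,
          hb0]))
    simp only [List.map_append, List.map_cons, List.prod_append, List.prod_cons, add_mul, mul_add,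
      map_add, ← Algebra.smul_def, mul_smul_comm, map_smul, smul_eq_mul, List.map_map] at h0
    simp only [List.map_append, List.map_cons, List.prod_append, List.prod_cons, List.map_nil,
      List.prod_nil, mul_one] at ih
    simp only [derivProd, List.map_cons, omitSum, mul_add, map_add, ← mul_assoc, ih, List.map_map]
    have h2 : (List.map (Prod.snd ∘ fun p : ι × A × A => (p.1, p.2.1)) w) =
      List.map (fun p => p.2.1) w := rfl
    rw [h2] at h0 ⊢
    rw [← mul_assoc] at h0
    linear_combination h0

theorem map_mul_derivProd_scalar (l : List (ι × A)) : ∀ c : A,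
    φ (c * derivProd (l.map fun p => (p.1, p.2, algebraMap ℂ A (-φ' p.2)))) =
      - omitSum φ φ' c l := by
  induction l with
  | nil => intro c; simp [derivProd, omitSum]
  | cons p l ih =>
    intro c
    have h2 : (List.map ((fun p : ι × A × A => p.2.1) ∘
      fun p : ι × A => (p.1, p.2, algebraMap ℂ A (-φ' p.2))) l) = List.map Prod.snd l := rfl
    simp only [List.map_cons, derivProd, omitSum, mul_add, map_add, ← mul_assoc, ih,
      List.map_map, h2]
    rw [mul_assoc c (algebraMap ℂ A _), ← Algebra.smul_def, mul_smul_comm, map_smul, smul_eq_mul]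
    ring

theorem isFreeFamily_dualFunctional (h1 : φ 1 = 1) (h : InfinitesimallyFree φ φ' B)
    (hC : ∀ i, ∀ z ∈ C i, ∃ a ∈ B i, ∃ b ∈ B i, z = dual a b) :
    IsFreeFamily (dualFunctional φ φ') C := by
  obtain ⟨hfree, hleib⟩ := (infinitesimallyFree_iff h1).1 h
  intro l hl hw
  have hex : ∃ w : List (ι × A × A), l = w.map (fun p => (p.1, dual p.2.1 p.2.2)) ∧
      ∀ p ∈ w, p.2.1 ∈ B p.1 ∧ p.2.2 ∈ B p.1 := by
    have hmem : ∀ p ∈ l, p.2 ∈ C p.1 := fun p hp => (hw.2 p hp).1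
    clear hw hl
    induction l with
    | nil => exact ⟨[], rfl, by simp⟩
    | cons p l ih =>
      obtain ⟨w, rfl, hw⟩ := ih fun q hq => hmem q (List.mem_cons_of_mem _ hq)
      obtain ⟨a, ha, b, hb, hz⟩ := hC _ _ (hmem p List.mem_cons_self)
      refine ⟨(p.1, a, b) :: w, by simp [← hz], ?_⟩
      intro q hq
      rcases List.mem_cons.1 hq with rfl | hq
      · exact ⟨ha, hb⟩
      · exact hw q hq
  obtain ⟨w, rfl, hwB⟩ := hex
  have h0 : ∀ p ∈ w, φ p.2.1 = 0 ∧ φ' p.2.1 + φ p.2.2 = 0 := fun p hp =>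
    dualFunctional_dual_eq_zero.1 (hw.2 _ (List.mem_map_of_mem hp)).2
  have hc : IsCentredWord φ B (w.map fun p => (p.1, p.2.1)) := by
    refine ⟨?_, ?_⟩
    · have := hw.1
      rw [List.isChain_map] at this ⊢
      exact this
    · intro q hq
      obtain ⟨p, hp, rfl⟩ := List.mem_map.1 hq
      exact ⟨(hwB p hp).1, (h0 p hp).1⟩
  have hne : (w.map fun p => (p.1, p.2.1)) ≠ [] := by simpa using hl
  have e1 := hfree _ hne hc
  have e2 := hleib _ hne hc
  have e3 := map_mul_derivProd (φ' := φ') h1 hfree w [] hc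
    fun p hp => ⟨(hwB p hp).2, (h0 p hp).2⟩
  rw [List.map_nil, List.prod_nil, one_mul] at e3
  rw [List.map_map] at e1 e2 ⊢
  change dualFunctional φ φ' (w.map fun p => dual p.2.1 p.2.2).prod = 0
  rw [prod_map_dual, dualFunctional_dual_eq_zero, e3]
  refine ⟨e1, ?_⟩
  rw [← e2]
  exact add_neg_cancel _

/-- A letter a with φ a = 0 lifts to the centred element a - εφ'(a). The coefficient of ε in the
expectation of the lifted word is φ' of the product minus the Leibniz sum. -/
theorem infinitesimallyFree_of_isFreeFamily (h1 : φ 1 = 1)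
    (h : IsFreeFamily (dualFunctional φ φ') C) (hB : ∀ i, ∀ a ∈ B i, dual a 0 ∈ C i) :
    InfinitesimallyFree φ φ' B := by
  rw [infinitesimallyFree_iff h1]
  have key : ∀ l : List (ι × A), l ≠ [] → IsCentredWord φ B l →
      φ (l.map Prod.snd).prod = 0 ∧ φ' (l.map Prod.snd).prod = omitSum φ φ' 1 l := by
    intro l hl hw
    set w : List (ι × A × A) := l.map fun p => (p.1, p.2, algebraMap ℂ A (-φ' p.2)) with hwdef
    have hc : IsCentredWord (dualFunctional φ φ') C (w.map fun p => (p.1, dual p.2.1 p.2.2)) := by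
      refine ⟨?_, ?_⟩
      · rw [hwdef, List.map_map, List.isChain_map]
        exact hw.1
      · intro q hq
        rw [hwdef, List.map_map] at hq
        obtain ⟨p, hp, rfl⟩ := List.mem_map.1 hq
        obtain ⟨hp1, hp2⟩ := hw.2 p hp
        constructor
        · have : dual p.2 (algebraMap ℂ A (-φ' p.2)) =
              dual p.2 0 + algebraMap (DualScalar) _ (⟨0, -φ' p.2⟩ : DualScalar) := by
            rw [algebraMap_eq_dual, dual_add]
            simp
          simp only [Function.comp_apply]
          rw [this]
          exact (C p.1).add_mem (hB _ _ hp1) ((C p.1).algebraMap_mem _)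
        · simp only [Function.comp_apply]
          rw [dualFunctional_dual_eq_zero]
          refine ⟨hp2, ?_⟩
          rw [Algebra.algebraMap_eq_smul_one, map_smul, h1, smul_eq_mul, mul_one, add_neg_cancel]
    have h0 := h _ (by simpa [hwdef] using hl) hc
    rw [List.map_map] at h0
    change dualFunctional φ φ' (w.map fun p => dual p.2.1 p.2.2).prod = 0 at h0
    rw [prod_map_dual, dualFunctional_dual_eq_zero] at h0
    have h3 := map_mul_derivProd_scalar (φ := φ) (φ' := φ') l 1
    rw [one_mul, ← hwdef] at h3
    rw [h3, hwdef, List.map_map] at h0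
    exact ⟨h0.1, add_neg_eq_zero.1 h0.2⟩
  exact ⟨fun l hl hw => (key l hl hw).1, fun l hl hw => (key l hl hw).2⟩

variable {X : ι → Set A}

theorem infinitesimallyFreeSets_iff (h1 : φ 1 = 1) :
    InfinitesimallyFreeSets φ φ' X ↔ IsFreeFamily (dualFunctional φ φ')
      fun i => Algebra.adjoin (DualScalar) ((fun a => dual a 0) '' X i) := by
  constructor
  · intro h
    refine isFreeFamily_dualFunctional h1 h fun i z hz => ?_
    induction hz using Algebra.adjoin_induction with
    | mem z hz =>
      obtain ⟨a, ha, rfl⟩ := hz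
      exact ⟨a, Algebra.subset_adjoin ha, 0, zero_mem _, rfl⟩
    | algebraMap t =>
      exact ⟨_, Subalgebra.algebraMap_mem _ _, _, Subalgebra.algebraMap_mem _ _,
        algebraMap_eq_dual t⟩
    | add y z _ _ hy hz =>
      obtain ⟨a, ha, b, hb, rfl⟩ := hy
      obtain ⟨a', ha', b', hb', rfl⟩ := hz
      exact ⟨_, add_mem ha ha', _, add_mem hb hb', dual_add _ _ _ _⟩
    | mul y z _ _ hy hz =>
      obtain ⟨a, ha, b, hb, rfl⟩ := hy
      obtain ⟨a', ha', b', hb', rfl⟩ := hz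
      exact ⟨_, mul_mem ha ha', _, add_mem (mul_mem ha hb') (mul_mem hb ha'), dual_mul _ _ _ _⟩
  · intro h
    refine infinitesimallyFree_of_isFreeFamily h1 h fun i a ha => ?_
    induction ha using Algebra.adjoin_induction with
    | mem a ha => exact Algebra.subset_adjoin ⟨a, ha, rfl⟩
    | algebraMap t =>
      have := Subalgebra.algebraMap_mem (Algebra.adjoin (DualScalar)
        ((fun a => dual a (0 : A)) '' X i)) (⟨t, 0⟩ : DualScalar)
      rw [algebraMap_eq_dual] at this
      simpa using this
    | add a b _ _ ha hb =>
      have := add_mem ha hb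
      rwa [dual_add, add_zero] at this
    | mul a b _ _ ha hb =>
      have := mul_mem ha hb
      rwa [dual_mul, mul_zero, zero_mul, add_zero] at this

theorem dual_pow (a : A) (n : ℕ) : dual a 0 ^ n = dual (a ^ n) 0 := by
  induction n with
  | zero => simp [dual_one]
  | succ n ih => rw [pow_succ, ih, dual_mul, pow_succ]; simp

theorem blockMoment_const (f : A →ₗ[ℂ] ℂ) {n : ℕ} (y : A) (V : Finset (Fin n)) :
    blockMoment f (fun _ => y) V = f (y ^ V.card) := by
  simp [blockMoment]

/-- The coefficient of ε in a product over blocks marks one block V for φ' and leaves φ on the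
others, which is the shape of `infCumulant`. -/
theorem cumulantSeq_dualFunctional (y : A) (n : ℕ) :
    cumulantSeq (fun a => dualFunctional φ φ' (dual y 0 ^ a)) n =
      ⟨cumulant φ fun _ : Fin n => y, infCumulant φ φ' fun _ : Fin n => y⟩ := by
  simp only [cumulantSeq, cumulant, infCumulant, dual_pow, dualFunctional_dual, map_zero, add_zero,
    blockMoment_const, DualScalar.algebraMap_def]
  ext
  · simp only [DualScalar.fst_sum, DualScalar.fst_mul, DualScalar.fst_prod]
  · simp only [DualScalar.snd_sum, DualScalar.snd_mul, DualScalar.snd_prod, zero_mul, add_zero,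
      Finset.mul_sum, mul_assoc]

end DualNumbers

/-! ### Transfer from the dual numbers to (φ, φ'). -/

section Compressions

open scoped TensorProduct

variable {A : Type*} [Ring A] [Algebra ℂ A] {φ φ' : A →ₗ[ℂ] ℂ} {x : A}

theorem dualFunctional_one (h1 : φ 1 = 1) (h1' : φ' 1 = 0) : dualFunctional φ φ' 1 = 1 := by
  rw [← dual_one, dualFunctional_dual, map_zero, h1, h1', add_zero]
  rfl

theorem dualFunctional_pow_eq_stackMoment (h1 : φ 1 = 1) (h1' : φ' 1 = 0) {y : A}
    {c : ℕ → DualScalar} (hc : ∀ n, 1 ≤ n → c n =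
      ⟨cumulant φ fun _ : Fin n => y, infCumulant φ φ' fun _ : Fin n => y⟩) (a : ℕ) :
    dualFunctional φ φ' (dual y 0 ^ a) = stackMoment c a 0 := by
  rcases Nat.eq_zero_or_pos a with rfl | ha
  · rw [pow_zero, dualFunctional_one h1 h1']
    rfl
  · refine eq_of_cumulantSeq_eq (μ := fun a => dualFunctional φ φ' (dual y 0 ^ a))
      (ν := fun a => stackMoment c a 0) (fun n hn => ?_) a ha
    rw [cumulantSeq_dualFunctional, cumulantSeq_stackMoment c hn, hc n hn]

theorem cumulants_of_dualFunctional_pow {y : A} {c : ℕ → DualScalar}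
    (hc : ∀ a, dualFunctional φ φ' (dual y 0 ^ a) = stackMoment c a 0) (n : ℕ) (hn : 1 ≤ n) :
    (cumulant φ fun _ : Fin n => y) = (c n).fst ∧
      (infCumulant φ φ' fun _ : Fin n => y) = (c n).snd := by
  have h := cumulantSeq_dualFunctional (φ := φ) (φ' := φ') y n
  simp only [hc] at h
  rw [cumulantSeq_stackMoment c hn] at h
  rw [h]
  exact ⟨rfl, rfl⟩

theorem dual_compression (x e : A) : dual (x * e * x) 0 = dual x 0 * dual e 0 * dual x 0 := by
  simp [dual_mul]

variable [StarRing A]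

theorem IsStandardInfSemicircular.dualFunctional_pow (h1 : φ 1 = 1) (h1' : φ' 1 = 0)
    (hx : IsStandardInfSemicircular φ φ' x) (a : ℕ) :
    dualFunctional φ φ' (dual x 0 ^ a) =
      stackMoment (semicircularCumulants (⟨0, infCumulant φ φ' fun _ : Fin 1 => x⟩ : DualScalar)
        ⟨1, infCumulant φ φ' fun _ : Fin 2 => x⟩) a 0 := by
  refine dualFunctional_pow_eq_stackMoment h1 h1' (fun n hn => ?_) a
  rcases n with _ | _ | _ | n
  · omega
  · simp [semicircularCumulants, hx.cumulant_one]
  · simp [semicircularCumulants, hx.cumulant_two]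
  · rw [hx.cumulant_eq_zero (n + 3) (by omega), hx.infCumulant_eq_zero (n + 3) (by omega)]
    simp only [semicircularCumulants, Nat.add_eq_right, Nat.reduceEqDiff, if_false]
    rfl

/-- The second moment over the dual numbers is m² + v, and m² = 0 because m is a multiple of ε;
compare coefficients of ε. -/
theorem IsStandardInfSemicircular.infCumulant_two (h1 : φ 1 = 1) (h1' : φ' 1 = 0)
    (hx : IsStandardInfSemicircular φ φ' x) :
    (infCumulant φ φ' fun _ : Fin 2 => x) = φ' (x ^ 2) := by
  have h := hx.dualFunctional_pow h1 h1' 2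
  rw [dual_pow, dualFunctional_dual] at h
  have h2 := congrArg DualScalar.snd h
  simp [stackMoment, semicircularCumulants, Finset.sum_range_succ] at h2
  exact h2.symm

theorem DualScalar.mk_one_pow (t : ℂ) (n : ℕ) : (⟨1, t⟩ : DualScalar) ^ n = ⟨1, n * t⟩ := by
  induction n with
  | zero => rw [pow_zero]; ext <;> simp
  | succ n ih => rw [pow_succ, ih]; ext <;> simp; ring

variable {κ : Type*} {e : κ → A}

theorem compression_words [DecidableEq κ] (h1 : φ 1 = 1) (h1' : φ' 1 = 0)
    (hx : IsStandardInfSemicircular φ φ' x) (he : ∀ i, e i * e i = e i)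
    (horth : ∀ i j, i ≠ j → e i * e j = 0)
    (hfree : InfinitesimallyFreeSets φ φ' ![Set.range e, {x}]) (l : List κ) (hl : l ≠ []) :
    dualFunctional φ φ' (poissonWord (fun i => dualFunctional φ φ' (dual (e i) 0))
      (⟨1, φ' (x ^ 2)⟩ : DualScalar) (fun i => dual (x * e i * x) 0) l) = 0 := by
  rw [← hx.infCumulant_two h1 h1']
  simp only [dual_compression]
  refine map_poissonWord_compression (dualFunctional_one h1 h1')
    ((infinitesimallyFreeSets_iff h1).1 hfree) ?_ ?_ (hx.dualFunctional_pow h1 h1') ?_ ?_ ?_ l hl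
  · exact Algebra.subset_adjoin ⟨x, rfl, rfl⟩
  -- The mean of x is a multiple of ε because κ₁(x) = 0, so its square vanishes.
  · ext <;> simp
  · exact fun i => Algebra.subset_adjoin ⟨e i, ⟨i, rfl⟩, rfl⟩
  · intro i
    rw [dual_mul, he]
    simp
  · intro i j hij
    rw [dual_mul, horth i j hij]
    simp [dual]

theorem infinitesimallyFreeSets_compression [DecidableEq κ] (h1 : φ 1 = 1) (h1' : φ' 1 = 0)
    (hx : IsStandardInfSemicircular φ φ' x) (he : ∀ i, e i * e i = e i)
    (horth : ∀ i j, i ≠ j → e i * e j = 0)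
    (hfree : InfinitesimallyFreeSets φ φ' ![Set.range e, {x}]) :
    InfinitesimallyFreeSets φ φ' (fun i => ({x * e i * x} : Set A)) := by
  rw [infinitesimallyFreeSets_iff h1]
  simp only [Set.image_singleton]
  exact isFreeFamily_of_poissonWord (dualFunctional_one h1 h1')
    (compression_words h1 h1' hx he horth hfree)

theorem cumulants_compression [DecidableEq κ] (h1 : φ 1 = 1) (h1' : φ' 1 = 0)
    (hx : IsStandardInfSemicircular φ φ' x) (he : ∀ i, e i * e i = e i)
    (horth : ∀ i j, i ≠ j → e i * e j = 0)
    (hfree : InfinitesimallyFreeSets φ φ' ![Set.range e, {x}]) (i : κ) (n : ℕ) (hn : 1 ≤ n) :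
    (cumulant φ fun _ : Fin n => x * e i * x) = φ (e i) ∧
      (infCumulant φ φ' fun _ : Fin n => x * e i * x) =
        φ' (e i) + n * (φ' (x ^ 2) * φ (e i)) := by
  obtain ⟨h2, h3⟩ := cumulants_of_dualFunctional_pow (map_pow_of_poissonWord
    (dualFunctional_one h1 h1') (compression_words h1 h1' hx he horth hfree) i) n hn
  rw [h2, h3, DualScalar.mk_one_pow, dualFunctional_dual]
  simp [mul_assoc]

end Compressions

end InfFree

/-! ### The corollary: reality and positivity of the parameters. -/

theorem corollary5p10 {A : Type*} [Ring A] [StarRing A] [Algebra ℂ A] [StarModule ℂ A]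
    (φ φ' : A →ₗ[ℂ] ℂ) (hφ : InfFree.IsStarIncps φ φ')
    (x : A) (hx : InfFree.IsStandardInfSemicircular φ φ' x)
    (k : ℕ) (e : Fin k → A) (he : ∀ i, IsStarProjection (e i))
    (horth : ∀ i j, i < j → e i * e j = 0)
    (hfree : InfFree.InfinitesimallyFreeSets φ φ' ![Set.range e, {x}]) :
    InfFree.InfinitesimallyFreeSets φ φ' (fun i : Fin k => ({x * e i * x} : Set A)) ∧
    ∀ i : Fin k, ∃ l β γ : ℝ,
      (l : ℂ) = φ (e i) ∧ (β : ℂ) = φ' (e i) ∧ (γ : ℂ) = φ' (x ^ 2) * φ (e i) ∧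
      IsSelfAdjoint (x * e i * x) ∧
      InfFree.HasInfFreePoissonCumulants φ φ' (x * e i * x) l β γ ∧
      (φ (e i) ≠ 0 → InfFree.IsInfFreePoisson φ φ' (x * e i * x) l β γ) := by
  have hidem : ∀ i, e i * e i = e i := fun i => (he i).isIdempotentElem
  have hstar : ∀ i, star (e i) = e i := fun i => (he i).isSelfAdjoint
  have horth' : ∀ i j, i ≠ j → e i * e j = 0 := by
    intro i j hij
    rcases lt_or_gt_of_ne hij with h | h
    · exact horth i j h
    · rw [← hstar i, ← hstar j, ← star_mul, horth j i h, star_zero]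
  refine ⟨InfFree.infinitesimallyFreeSets_compression hφ.map_one hφ.map_one' hx hidem horth' hfree,
    fun i => ?_⟩
  have hcum := InfFree.cumulants_compression hφ.map_one hφ.map_one' hx hidem horth' hfree i
  -- Positivity of φ applies because e i = star (e i) * e i.
  have hpos : 0 ≤ (φ (e i)).re ∧ 0 = (φ (e i)).im := by
    have h := hφ.nonneg (e i)
    rw [hstar, hidem] at h
    exact Complex.nonneg_iff.1 h
  have hreal : ∀ a : A, star a = a → ((φ' a).re : ℂ) = φ' a := by
    intro a ha
    have h := hφ.selfAdjoint a
    rw [ha] at h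
    exact Complex.conj_eq_iff_re.1 h.symm
  have hl : ((φ (e i)).re : ℂ) = φ (e i) := Complex.ext rfl hpos.2
  have hβ := hreal (e i) (hstar i)
  have hγ : (((φ' (x ^ 2)).re * (φ (e i)).re : ℝ) : ℂ) = φ' (x ^ 2) * φ (e i) := by
    rw [Complex.ofReal_mul, hl, hreal _ (by rw [star_pow, hx.isSelfAdjoint.star_eq])]
  have hsa : IsSelfAdjoint (x * e i * x) := by
    rw [isSelfAdjoint_iff, star_mul, star_mul, hx.isSelfAdjoint.star_eq, hstar, mul_assoc]
  have hcum' : InfFree.HasInfFreePoissonCumulants φ φ' (x * e i * x) (φ (e i)).re (φ' (e i)).re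
      ((φ' (x ^ 2)).re * (φ (e i)).re) := by
    intro n hn
    rw [hl, hβ, hγ]
    exact hcum n hn
  refine ⟨_, _, _, hl, hβ, hγ, hsa, hcum', fun hne => ⟨?_, hsa, hcum'⟩⟩
  refine lt_of_le_of_ne hpos.1 fun h => hne ?_
  rw [← hl, ← h, Complex.ofReal_zero]
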